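/- Let $K$ be an algebraically closed field of characteristic zero, let $n\ge 0$ and $d\ge 2$, and let $$P = Z^d + a_2(X) Z^{d-2} + \cdots + a_d(X) \in K[[X_1,\dots,X_n]][Z]$$ be a Weierstrass polynomial (that is, $a_i(0)=0$ for all $i$) with no term of degree $d-1$ in $Z$ (that is, $a_1=0$). Assume that $P$ is quasi-ordinary, i.e. that its discriminant is $X_1^{\alpha_1}\cdots X_n^{\alpha_n}U(X)$ with $\alpha_i\in\mathbb{N}$ and $U(0)\neq 0$. Then the following three conclusions hold. 1. The ideal $(a_i^{d!/i})_{i=2,\dots,d}\subset K[[X]]$ is monomial, i.e. generated by a monomial $X^\gamma$, and it is generated by one of the $a_i^{d!/i}$, $2\le i\le d$. 2. $P$ is $\nu$-quasi-ordinary, in the following sense. Write $P=\sum P_{m,k}X^mZ^k$ with $P_{m,k}\in K$, let $NP(P)\subset\mathbb{R}^{n}\times\mathbb{R}$ (the Newton polyhedron) be the convex hull of the union of the sets $(m,k)+\mathbb{R}_{\ge 0}^{n+1}$ over all $(m,k)$ with $P_{m,k}\ne 0$, and let $R_0=(0,\dots,0,d)$. There is a point $R_1\neq R_0$ of $NP(P)$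 such that, if $R_1'$ denotes the projection of $R_1$ from $R_0$ onto $\mathbb{R}^n\times 0$ and $S$ the segment joining $R_0$ and $R_1'$, one has $NP(P)\subset\bigcup_{s\in S}(s+\mathbb{R}_{\ge 0}^{n+1})$, and $P_S=\sum_{(m,k)\in S}P_{m,k}X^mZ^k$ is not a power of a linear form in $Z$. 3. $NP(P)$ has exactly one compact edge (compact one-dimensional face) containing $R_0$. -/

import Mathlib

noncomputable section

namespace AbhyankarJung

variable {K : Type*} [Field K] {n : ℕ}

/-- The coefficient `a_i` of `P = Z^d + a_1 Z^(d-1) + ⋯ + a_d`, where `d = deg P`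
(used for `i ≤ d` only). -/
def coef (P : Polynomial (MvPowerSeries (Fin n) K)) (i : ℕ) : MvPowerSeries (Fin n) K :=
  P.coeff (P.natDegree - i)

/-- `P` is a Weierstrass polynomial of degree `d`:
`P = Z^d + a_1 Z^(d-1) + ⋯ + a_d` with `a_i(0) = 0` for `i = 1, …, d`. -/
def IsWeierstrass (P : Polynomial (MvPowerSeries (Fin n) K)) (d : ℕ) : Prop :=
  P.Monic ∧ P.natDegree = d ∧
    ∀ i ∈ Finset.Icc 1 d, MvPowerSeries.constantCoeff (coef P i) = 0

/-- `P` is quasi-ordinary: its discriminant is a monomial `X^α` times a unit `U`. -/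
def IsQuasiOrdinary (P : Polynomial (MvPowerSeries (Fin n) K)) : Prop :=
  ∃ (α : Fin n →₀ ℕ) (U : MvPowerSeries (Fin n) K),
    MvPowerSeries.constantCoeff U ≠ 0 ∧ P.discr = MvPowerSeries.monomial α 1 * U

/-- The ideal `(a_i^(d!/i))_{i = 2, …, d}` of `K[[X]]`, where `d = deg P`. -/
def coefIdeal (P : Polynomial (MvPowerSeries (Fin n) K)) : Ideal (MvPowerSeries (Fin n) K) :=
  Ideal.span {f | ∃ i ∈ Finset.Icc 2 P.natDegree, f = coef P i ^ (P.natDegree.factorial / i)}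

/-- The exponent `(m, k) ∈ ℕ^n × ℕ`, as a point of `ℝ^n × ℝ = ℝ^(n+1)`. -/
def latticePoint (m : Fin n →₀ ℕ) (k : ℕ) : (Fin n → ℝ) × ℝ :=
  (fun j => (m j : ℝ), (k : ℝ))

/-- The set of exponents of the monomials `X^m Z^k` that occur in `P`. -/
def exponents (P : Polynomial (MvPowerSeries (Fin n) K)) : Set ((Fin n → ℝ) × ℝ) :=
  {p | ∃ (m : Fin n →₀ ℕ) (k : ℕ),
    MvPowerSeries.coeff m (P.coeff k) ≠ 0 ∧ p = latticePoint m k}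

/-- The Newton polyhedron of `P`: the convex hull of `⋃ a, (a + ℝ_{≥0}^(n+1))`, where `a` runs
over the exponents of `P`. The order on `ℝ^n × ℝ` is the componentwise one, so
`a + ℝ_{≥0}^(n+1)` is `Set.Ici a`. -/
def newtonPolyhedron (P : Polynomial (MvPowerSeries (Fin n) K)) : Set ((Fin n → ℝ) × ℝ) :=
  convexHull ℝ (⋃ a ∈ exponents P, Set.Ici a)

/-- The point `R₀ = (0, …, 0, d)`, where `d = deg P`. -/
def topPoint (P : Polynomial (MvPowerSeries (Fin n) K)) : (Fin n → ℝ) × ℝ :=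
  (0, (P.natDegree : ℝ))

open Classical in
/-- The power series obtained from `f` by keeping exactly the terms `f_m X^m` with `(m, k) ∈ S`. -/
def restrictSeries (f : MvPowerSeries (Fin n) K) (k : ℕ) (S : Set ((Fin n → ℝ) × ℝ)) :
    MvPowerSeries (Fin n) K :=
  fun m => if latticePoint m k ∈ S then MvPowerSeries.coeff m f else 0

/-- `P_S`: the sum of the terms of `P` whose exponent lies in `S`. -/
def restrict (P : Polynomial (MvPowerSeries (Fin n) K)) (S : Set ((Fin n → ℝ) × ℝ)) :
    Polynomial (MvPowerSeries (Fin n) K) :=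
  ∑ k ∈ Finset.range (P.natDegree + 1), Polynomial.monomial k (restrictSeries (P.coeff k) k S)

/-- `Q` is a power of a linear form `a Z + b` in `Z`. -/
def IsPowerOfLinearForm (Q : Polynomial (MvPowerSeries (Fin n) K)) : Prop :=
  ∃ (a b : MvPowerSeries (Fin n) K) (k : ℕ),
    Q = (Polynomial.C a * Polynomial.X + Polynomial.C b) ^ k

/-- `P` is `ν`-quasi-ordinary: there is a point `R₁ ≠ R₀` of the Newton polyhedron such that, with
`R₁'` the projection of `R₁` from `R₀` to `ℝ^n × 0` (the point of the line `R₀R₁` in `ℝ^n × 0`)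
and `S` the segment from `R₀` to `R₁'`, the Newton polyhedron is contained in
`⋃ s ∈ S, (s + ℝ_{≥0}^(n+1))` and `P_S` is not a power of a linear form in `Z`. -/
def IsNuQuasiOrdinary (P : Polynomial (MvPowerSeries (Fin n) K)) : Prop :=
  ∃ R₁ ∈ newtonPolyhedron P, R₁ ≠ topPoint P ∧
    ∃ R₁' : (Fin n → ℝ) × ℝ, R₁'.2 = 0 ∧ R₁' ∈ affineSpan ℝ {topPoint P, R₁} ∧
      newtonPolyhedron P ⊆ (⋃ s ∈ segment ℝ (topPoint P) R₁', Set.Ici s) ∧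
      ¬ IsPowerOfLinearForm (restrict P (segment ℝ (topPoint P) R₁'))

/-- `F` is a compact edge (compact one-dimensional face) of the polyhedron `N`. -/
def IsCompactEdge (N F : Set ((Fin n → ℝ) × ℝ)) : Prop :=
  F.Nonempty ∧ IsExposed ℝ N F ∧ IsCompact F ∧ Module.finrank ℝ (vectorSpan ℝ F) = 1

end AbhyankarJung

end

/-!
Let `R = K[[X]]` and let `z`, `z'` be roots of `P` in an algebraic closure `L` of `Frac R`. The
quotients `X ^ α / (z - z')` are integral over `R`, since `z - z'` divides `P'(z)`, which divides
the discriminant. The proof avoids the theorem that the roots are fractional power series and works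
with the orders of `z - z'` along the coordinate hyperplanes `X_l = 0` instead.

These orders are defined by places: embeddings of `L` into Hahn series with rational exponents that
extend the expansion in powers of `X_l`. Places exist by the Newton–Puiseux theorem. As `R` is
integrally closed, an element of `L` with monomial denominator and without poles at the places is
integral (`isIntegral_of_orderTop_nonneg`). As `R` is complete, an integral element that takes a
constant value `c` at one place is congruent to `c` at the closed point, hence `c` does not depend
on the place, and the element is a unit if `c ≠ 0` (`minpoly_map_constantCoeff`).

Apply this to the logarithmic derivative of `z - z'` along `X_l ∂/∂X_l`. It is integral, and its
value at a place over `X_l = 0` is the order of `z - z'` there. So the order is the same at all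
places over `X_l = 0`; this gives a vector of orders for each pair of roots. Comparing the
logarithmic derivatives of the three differences of three roots shows that the vectors of the
differences with a fixed root `x` are totally ordered (`orderTop_sub_comparable`). Let `δ` be the
smallest of them, the vector of `x - y`. Because the sum of the roots is zero, all roots have order
at least `δ`, so the exponents of the coefficient `a_i` are at least `i δ`. Because `(X ^ δ) / (x -
y)` is integral, the roots cannot all be smaller than `X ^ δ` with respect to a valuation centred at
the closed point, which means that some `a_i` has a term with exponent exactly `i δ`
(`exists_coef_eq_monomial_mul`).

So there are `i₀` and `β` such that `a_{i₀}` is `X ^ β` times a unit and `m / i ≥ β / i₀` for all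
exponents `m` of all `a_i` (`HasDominantCoef`). The three conclusions follow from this by convex
geometry. The compact edge is the part of the Newton polyhedron on the segment from the top point
through `(β, d - i₀)`. -/

noncomputable section

namespace AbhyankarJung

open Polynomial

/-! ### Factorization over complete local rings -/

/-- A form of Hensel's lemma: over a complete local ring, a monic polynomial whose reduction has the
root `0` but is not a power of `X` is a product of monic polynomials of smaller degree. The first
factor is the one given by the Weierstrass preparation theorem, and it divides as a polynomial
because Weierstrass division is unique. -/
theorem exists_monic_factor_of_residue_root {A : Type*} [CommRing A] [IsLocalRing A]
    [IsAdicComplete (IsLocalRing.maximalIdeal A) A] {p : A[X]} (hp : p.Monic)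
    (h0 : p.coeff 0 ∈ IsLocalRing.maximalIdeal A) {k : ℕ} (hk : k < p.natDegree)
    (hpk : p.coeff k ∉ IsLocalRing.maximalIdeal A) :
    ∃ f g : A[X], f.Monic ∧ g.Monic ∧ p = f * g ∧
      f.natDegree < p.natDegree ∧ g.natDegree < p.natDegree := by
  set P : PowerSeries A := (p : PowerSeries A) with hP
  have hne : P.map (IsLocalRing.residue A) ≠ 0 := by
    intro h
    have := congrArg (PowerSeries.coeff k) h
    simp only [PowerSeries.coeff_map, hP, coeff_coe, map_zero,
      IsLocalRing.residue_eq_zero_iff] at this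
    exact hpk this
  obtain ⟨f, h, H⟩ := PowerSeries.exists_isWeierstrassFactorization hne
  have hf : f.Monic := H.isDistinguishedAt.monic
  have hdeg := H.natDegree_eq_toNat_order_map
  have hfk : f.natDegree ≤ k := by
    rw [hdeg]
    apply ENat.toNat_le_of_le_natCast
    apply PowerSeries.order_le
    simpa [PowerSeries.coeff_map, hP, coeff_coe, IsLocalRing.residue_eq_zero_iff] using hpk
  have hf0 : f.natDegree ≠ 0 := by
    intro h1
    have hf1 : f = 1 := hf.natDegree_eq_zero.mp h1
    have hu := H.isUnit
    have he := H.eq_mul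
    rw [hf1, Polynomial.coe_one, one_mul] at he
    rw [← he, PowerSeries.isUnit_iff_constantCoeff] at hu
    rw [← PowerSeries.coeff_zero_eq_constantCoeff_apply, hP, coeff_coe] at hu
    exact (IsLocalRing.mem_maximalIdeal _).mp h0 hu
  have hr : p %ₘ f = 0 := by
    have hfne : (f : PowerSeries A).map (IsLocalRing.residue A) ≠ 0 := by
      rw [← Polynomial.polynomial_map_coe]
      exact_mod_cast (hf.map (IsLocalRing.residue A)).ne_zero
    have hford : ((f : PowerSeries A).map (IsLocalRing.residue A)).order.toNat = f.natDegree := by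
      rw [hdeg]
      have he : P.map (IsLocalRing.residue A) = (f : PowerSeries A).map (IsLocalRing.residue A) *
          h.map (IsLocalRing.residue A) := by rw [H.eq_mul, map_mul]
      rw [he, PowerSeries.order_mul, PowerSeries.order_zero_of_unit (H.isUnit.map _), add_zero]
    refine (PowerSeries.IsWeierstrassDivisor.of_map_ne_zero hfne).eq_zero_of_mul_eq
      (q := h - (p /ₘ f : A[X])) (r := p %ₘ f) ?_ ?_ |>.2
    · change _ < ((((f : PowerSeries A).map (IsLocalRing.residue A)).order.toNat : ℕ) : WithBot ℕ)
      rw [hford, ← degree_eq_natDegree hf.ne_zero]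
      exact degree_modByMonic_lt _ hf
    · have h1 := congrArg (fun x : A[X] => (x : PowerSeries A)) (modByMonic_add_div p f)
      simp only [Polynomial.coe_add, Polynomial.coe_mul] at h1
      rw [mul_sub, ← H.eq_mul, sub_eq_iff_eq_add, h1]
  have hfg : p = f * (p /ₘ f) := by
    conv_lhs => rw [← modByMonic_add_div p f, hr, zero_add]
  have hg : (p /ₘ f).Monic := hf.of_mul_monic_left (hfg ▸ hp)
  refine ⟨f, p /ₘ f, hf, hg, hfg, hfk.trans_lt hk, ?_⟩
  have := hf.natDegree_mul hg
  rw [← hfg] at this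
  omega

/-! ### Power series rings are complete and integrally closed -/

theorem maximalIdeal_mvPowerSeries {σ K : Type*} [Finite σ] [Field K] :
    IsLocalRing.maximalIdeal (MvPowerSeries σ K) = .span (.range MvPowerSeries.X) := by
  have hmem : ∀ f : MvPowerSeries σ K, f ∈ IsLocalRing.maximalIdeal (MvPowerSeries σ K) ↔
      MvPowerSeries.constantCoeff f = 0 := fun f => by
    rw [IsLocalRing.mem_maximalIdeal, mem_nonunits_iff, MvPowerSeries.isUnit_iff_constantCoeff,
      isUnit_iff_ne_zero, not_not]
  apply le_antisymm
  · intro f hf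
    rw [hmem] at hf
    -- group the monomials of `f` according to one of the variables they involve
    classical
    have := Fintype.ofFinite σ
    have hex : ∀ m : σ →₀ ℕ, m ≠ 0 → ∃ i, m i ≠ 0 := fun m hm => by
      by_contra! h
      exact hm (Finsupp.ext h)
    choose v hv using hex
    let g : σ → MvPowerSeries σ K := fun i m =>
      if ∃ h : m ≠ 0, v m h = i then MvPowerSeries.coeff m f else 0
    have hg : ∀ i m, MvPowerSeries.coeff m (g i) =
      if ∃ h : m ≠ 0, v m h = i then MvPowerSeries.coeff m f else 0 := fun _ _ => rfl
    have hsum : f = ∑ i, g i := by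
      ext m
      rw [map_sum]
      simp only [hg]
      by_cases hm : m = 0
      · subst hm
        simpa using hf
      · simp [hm]
    rw [hsum]
    refine Ideal.sum_mem _ fun i _ => ?_
    obtain ⟨r, hr⟩ := (MvPowerSeries.X_dvd_iff (s := i) (φ := g i)).mpr fun m hm => by
      rw [hg, if_neg]
      rintro ⟨h1, rfl⟩
      exact hv m h1 hm
    rw [hr]
    exact Ideal.mul_mem_right _ _ (Ideal.subset_span ⟨i, rfl⟩)
  · rw [Ideal.span_le]
    rintro _ ⟨i, rfl⟩
    exact (hmem _).mpr (by simp)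

instance {σ K : Type*} [Finite σ] [Field K] :
    IsAdicComplete (IsLocalRing.maximalIdeal (MvPowerSeries σ K)) (MvPowerSeries σ K) := by
  rw [maximalIdeal_mvPowerSeries]
  infer_instance

instance {K : Type*} [Field K] :
    IsAdicComplete (IsLocalRing.maximalIdeal (PowerSeries K)) (PowerSeries K) :=
  inferInstanceAs <| IsAdicComplete (IsLocalRing.maximalIdeal (MvPowerSeries Unit K))
    (MvPowerSeries Unit K)

section Divisibility

variable {K : Type*} [Field K] {n : ℕ}

/-- Division by `b` with respect to the lexicographically smallest exponent `e` of `b`: some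
multiple of `b` differs from `a` by a series without exponents in `e + ℕ ^ n`. -/
theorem exists_lex_quotient (a : MvPowerSeries (Fin n) K) {b : MvPowerSeries (Fin n) K}
    {e : Fin n →₀ ℕ} (he : b.lexOrder = toLex e) :
    ∃ q : MvPowerSeries (Fin n) K, ∀ m, MvPowerSeries.coeff (m + e) (a - q * b) = 0 := by
  classical
  have hbe := MvPowerSeries.coeff_ne_zero_of_lexOrder he.symm
  have wf : WellFounded (fun x y : Lex (Fin n →₀ ℕ) => x < y) := wellFounded_lt
  -- the coefficients of the quotient, by recursion along the lexicographic order
  let q : Lex (Fin n →₀ ℕ) → K := wf.fix fun m rec =>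
    (MvPowerSeries.coeff (ofLex m + e) a -
      ∑ p ∈ Finset.HasAntidiagonal.antidiagonal (ofLex m + e),
        if h : toLex p.1 < m then rec (toLex p.1) h * MvPowerSeries.coeff p.2 b else 0) /
      MvPowerSeries.coeff e b
  have hq : ∀ m, q m = (MvPowerSeries.coeff (ofLex m + e) a -
      ∑ p ∈ Finset.HasAntidiagonal.antidiagonal (ofLex m + e),
        if toLex p.1 < m then q (toLex p.1) * MvPowerSeries.coeff p.2 b else 0) /
      MvPowerSeries.coeff e b := by
    intro m
    simp only [q]
    rw [wf.fix_eq]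
    simp only [dite_eq_ite]
  obtain ⟨Q, hqc⟩ : ∃ Q : MvPowerSeries (Fin n) K,
      ∀ i, MvPowerSeries.coeff i Q = q (toLex i) := ⟨fun m => q (toLex m), fun _ => rfl⟩
  refine ⟨Q, fun m => ?_⟩
  rw [map_sub, MvPowerSeries.coeff_mul, sub_eq_zero]
  have h1 := hq (toLex m)
  rw [eq_div_iff hbe, ofLex_toLex, eq_sub_iff_add_eq] at h1
  rw [← h1, ← Finset.add_sum_erase (Finset.HasAntidiagonal.antidiagonal (m + e))
    (fun p => MvPowerSeries.coeff p.1 Q * MvPowerSeries.coeff p.2 b) (a := (m, e)) (by simp), hqc]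
  congr 1
  rw [← Finset.sum_erase (a := (m, e)) (Finset.HasAntidiagonal.antidiagonal (m + e))]
  · refine Finset.sum_congr rfl fun p hp => ?_
    rw [Finset.mem_erase, Finset.HasAntidiagonal.mem_antidiagonal] at hp
    split_ifs with hlt
    · rw [hqc]
    · rw [hqc]
      have : MvPowerSeries.coeff p.2 b = 0 := by
        apply MvPowerSeries.coeff_eq_zero_of_lt_lexOrder
        rw [he, WithTop.coe_lt_coe]
        by_contra hle
        rw [not_lt] at hle hlt
        have hs : toLex p.1 + toLex p.2 = toLex m + toLex e := congrArg toLex hp.2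
        have h3 : toLex p.1 = toLex m := by
          refine le_antisymm ?_ hlt
          by_contra hc
          rw [not_le] at hc
          exact absurd hs (ne_of_gt (add_lt_add_of_lt_of_le hc hle))
        have h4 : toLex p.2 = toLex e := by rw [h3] at hs; exact add_left_cancel hs
        exact hp.1 (Prod.ext h3 h4)
      rw [this, mul_zero]
  · simp

/-- The valuation argument behind complete integral closedness: compare the smallest exponents in
the lexicographic order, in each coordinate. -/
theorem le_of_pow_dvd {b r c : MvPowerSeries (Fin n) K} {e f : Fin n →₀ ℕ}
    (he : b.lexOrder = toLex e) (hf : r.lexOrder = toLex f) (hc : c ≠ 0)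
    (h : ∀ k : ℕ, b ^ k ∣ c * r ^ k) : e ≤ f := by
  obtain ⟨g, hg⟩ := MvPowerSeries.exists_finsupp_eq_lexOrder_of_ne_zero hc
  have hpow : ∀ (x : MvPowerSeries (Fin n) K) (d : Fin n →₀ ℕ), x.lexOrder = toLex d →
      ∀ k : ℕ, (x ^ k).lexOrder = toLex (k • d) := by
    intro x d hx k
    induction k with
    | zero =>
      rw [pow_zero, zero_smul]
      have h1 := MvPowerSeries.lexOrder_mul (1 : MvPowerSeries (Fin n) K) 1
      obtain ⟨o, ho⟩ := MvPowerSeries.exists_finsupp_eq_lexOrder_of_ne_zero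
        (one_ne_zero : (1 : MvPowerSeries (Fin n) K) ≠ 0)
      rw [mul_one, ho, ← WithTop.coe_add, WithTop.coe_inj] at h1
      rw [ho, WithTop.coe_inj]
      exact left_eq_add.mp h1
    | succ k ih =>
      rw [pow_succ, MvPowerSeries.lexOrder_mul, ih, hx, succ_nsmul]
      rfl
  intro i
  by_contra hlt
  rw [not_le] at hlt
  obtain ⟨s, hs⟩ := h (g i + 1)
  have hne : s ≠ 0 := by
    rintro rfl
    rw [mul_zero] at hs
    have hr : r ≠ 0 := by
      rintro rfl; simp at hf
    exact mul_ne_zero hc (pow_ne_zero _ hr) hs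
  obtain ⟨t, ht⟩ := MvPowerSeries.exists_finsupp_eq_lexOrder_of_ne_zero hne
  have h1 := congrArg MvPowerSeries.lexOrder hs
  rw [MvPowerSeries.lexOrder_mul, MvPowerSeries.lexOrder_mul, hg, ht, hpow _ _ hf, hpow _ _ he,
    ← WithTop.coe_add, ← WithTop.coe_add, WithTop.coe_inj] at h1
  have h2 : g i + (g i + 1) * f i = (g i + 1) * e i + t i := by
    have := DFunLike.congr_fun (congrArg ofLex h1) i
    simpa using this
  nlinarith

/-- The ring of power series is completely integrally closed. -/
theorem dvd_of_pow_dvd {a b c : MvPowerSeries (Fin n) K} (hb : b ≠ 0) (hc : c ≠ 0)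
    (h : ∀ k : ℕ, b ^ k ∣ c * a ^ k) : b ∣ a := by
  obtain ⟨e, he⟩ := MvPowerSeries.exists_finsupp_eq_lexOrder_of_ne_zero hb
  obtain ⟨q, hq⟩ := exists_lex_quotient a he
  suffices a - q * b = 0 from ⟨q, by rw [sub_eq_zero.mp this, mul_comm]⟩
  by_contra hr
  obtain ⟨f, hf⟩ := MvPowerSeries.exists_finsupp_eq_lexOrder_of_ne_zero hr
  have hle : e ≤ f := le_of_pow_dvd he hf hc fun k => by
    rw [sub_eq_add_neg, add_pow, Finset.mul_sum]
    refine Finset.dvd_sum fun j hj => ?_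
    rw [Finset.mem_range, Nat.lt_succ_iff] at hj
    obtain ⟨s, hs⟩ := h j
    refine ⟨s * ((-q) ^ (k - j) * (k.choose j)), ?_⟩
    obtain ⟨i, rfl⟩ := Nat.exists_eq_add_of_le hj
    rw [Nat.add_sub_cancel_left, ← neg_mul, mul_pow, pow_add b]
    linear_combination ((-q) ^ i * b ^ i * ((j + i).choose j : MvPowerSeries (Fin n) K)) * hs
  apply MvPowerSeries.coeff_ne_zero_of_lexOrder hf.symm
  rw [← tsub_add_cancel_of_le hle]
  exact hq _

instance : IsDomain (MvPowerSeries (Fin n) K) := NoZeroDivisors.to_isDomain _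

instance : IsIntegrallyClosed (MvPowerSeries (Fin n) K) := by
  rw [isIntegrallyClosed_iff (FractionRing (MvPowerSeries (Fin n) K))]
  intro x hx
  obtain ⟨c, hc, hx⟩ := hx.isAlmostIntegral
  obtain ⟨a, b, hb, rfl⟩ := IsFractionRing.div_surjective (A := MvPowerSeries (Fin n) K) x
  have hb0 := nonZeroDivisors.ne_zero hb
  have hinj := IsFractionRing.injective (MvPowerSeries (Fin n) K)
    (FractionRing (MvPowerSeries (Fin n) K))
  have hb1 : algebraMap _ (FractionRing (MvPowerSeries (Fin n) K)) b ≠ 0 := by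
    rwa [Ne, map_eq_zero_iff _ hinj]
  obtain ⟨s, rfl⟩ := dvd_of_pow_dvd (a := a) hb0 (nonZeroDivisors.ne_zero hc) fun k => by
    obtain ⟨y, hy⟩ := hx k
    refine ⟨y, hinj ?_⟩
    rw [map_mul, map_mul, map_pow, map_pow, hy, Algebra.smul_def, div_pow]
    field_simp
  exact ⟨s, by rw [map_mul]; field_simp⟩

theorem mem_maximalIdeal_iff (f : MvPowerSeries (Fin n) K) :
    f ∈ IsLocalRing.maximalIdeal (MvPowerSeries (Fin n) K) ↔
      MvPowerSeries.constantCoeff f = 0 := by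
  rw [IsLocalRing.mem_maximalIdeal, mem_nonunits_iff, MvPowerSeries.isUnit_iff_constantCoeff,
    isUnit_iff_ne_zero, not_not]

theorem monomial_dvd_iff (β : Fin n →₀ ℕ) (f : MvPowerSeries (Fin n) K) :
    MvPowerSeries.monomial β 1 ∣ f ↔ ∀ m, MvPowerSeries.coeff m f ≠ 0 → β ≤ m := by
  classical
  constructor
  · rintro ⟨g, rfl⟩ m hm
    by_contra h
    rw [MvPowerSeries.coeff_monomial_mul, if_neg h] at hm
    exact hm rfl
  · intro h
    obtain ⟨g, hg⟩ : ∃ g : MvPowerSeries (Fin n) K,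
        ∀ m, MvPowerSeries.coeff m g = MvPowerSeries.coeff (β + m) f := ⟨_, fun _ => rfl⟩
    refine ⟨g, ?_⟩
    ext m
    rw [MvPowerSeries.coeff_monomial_mul, one_mul]
    split_ifs with hm
    · rw [hg, add_tsub_cancel_of_le hm]
    · by_contra hne
      exact hm (h m hne)

end Divisibility

/-! ### The Newton–Puiseux theorem -/

section Puiseux

variable {k : Type*} [Field k]

theorem X_pow_dvd_iff_le_order (m : ℕ) (f : PowerSeries k) :
    PowerSeries.X ^ m ∣ f ↔ (m : ℕ∞) ≤ f.order := by
  rw [PowerSeries.X_pow_dvd_iff]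
  refine ⟨fun h => PowerSeries.nat_le_order f m h, fun h j hj => PowerSeries.coeff_of_lt_order j ?_⟩
  exact lt_of_lt_of_le (by exact_mod_cast hj) h

/-- The step along the first edge of the Newton polygon in the construction of Puiseux series:
after a substitution `X ↦ X ^ q` all roots of `p` become divisible by a power `s` of `X`, and the
polynomial `p₁` of the roots divided by `s` has a nonzero reduction apart from the leading term. -/
theorem exists_expand_eq_scaleRoots {p : (PowerSeries k)[X]} (hp : p.Monic)
    (hpX : p ≠ X ^ p.natDegree) (hnext : p.coeff (p.natDegree - 1) = 0) :
    ∃ (q : ℕ) (hq : q ≠ 0) (s : PowerSeries k) (p₁ : (PowerSeries k)[X]), p₁.Monic ∧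
      p₁.natDegree = p.natDegree ∧
      PowerSeries.constantCoeff (p₁.coeff (p.natDegree - 1)) = 0 ∧
      (∃ j < p.natDegree, PowerSeries.constantCoeff (p₁.coeff j) ≠ 0) ∧
      p.map (PowerSeries.expand q hq : PowerSeries k →ₐ[k] PowerSeries k).toRingHom =
        p₁.scaleRoots s := by
  classical
  set d := p.natDegree with hdd
  have hne : ((Finset.range d).filter fun j => p.coeff j ≠ 0).Nonempty := by
    by_contra h
    rw [Finset.not_nonempty_iff_eq_empty, Finset.filter_eq_empty_iff] at h
    refine hpX (Polynomial.ext fun j => ?_)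
    rw [coeff_X_pow]
    rcases lt_trichotomy j d with hj | hj | hj
    · rw [if_neg hj.ne, not_not.mp (h (Finset.mem_range.mpr hj))]
    · rw [if_pos hj, hj]; exact hp.coeff_natDegree
    · rw [if_neg hj.ne', coeff_eq_zero_of_natDegree_lt hj]
  let v : ℕ → ℕ := fun j => (p.coeff j).order.toNat
  have hv : ∀ j, p.coeff j ≠ 0 → (p.coeff j).order = v j := fun j hj =>
    (ENat.natCast_toNat (by rwa [Ne, PowerSeries.order_eq_top])).symm
  obtain ⟨j₀, hj₀, hmin⟩ := Finset.exists_min_image _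
    (fun j => (v j : ℚ) / ((d - j : ℕ) : ℚ)) hne
  rw [Finset.mem_filter, Finset.mem_range] at hj₀
  obtain ⟨hj₀d, hj₀0⟩ := hj₀
  have hq : d - j₀ ≠ 0 := by omega
  have hdvd : ∀ j < d, (PowerSeries.X : PowerSeries k) ^ (v j₀ * (d - j)) ∣
      PowerSeries.expand (d - j₀) hq (p.coeff j) := fun j hj => by
    by_cases h0 : p.coeff j = 0
    · rw [h0, map_zero]; exact dvd_zero _
    refine (X_pow_dvd_iff_le_order _ _).mpr ?_
    rw [PowerSeries.order_expand, hv j h0]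
    have h1 := hmin j (by simp [hj, h0])
    rw [div_le_div_iff₀ (by exact_mod_cast Nat.pos_of_ne_zero hq)
      (by exact_mod_cast (by omega : 0 < d - j))] at h1
    have h2 : v j₀ * (d - j) ≤ (d - j₀) * v j := by rw [mul_comm _ (v j)]; exact_mod_cast h1
    rw [nsmul_eq_mul]
    exact_mod_cast h2
  choose! b hb using hdvd
  let p₁ : (PowerSeries k)[X] := X ^ d + ∑ j ∈ Finset.range d, C (b j) * X ^ j
  have hdeg : (∑ j ∈ Finset.range d, C (b j) * X ^ j : (PowerSeries k)[X]).degree < d := by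
    refine (degree_sum_le _ _).trans_lt ((Finset.sup_lt_iff (WithBot.bot_lt_coe _)).mpr
      fun j hj => (degree_C_mul_X_pow_le _ _).trans_lt ?_)
    exact_mod_cast Finset.mem_range.mp hj
  have hp₁ : p₁.Monic := monic_X_pow_add hdeg
  have hp₁d : p₁.natDegree = d := natDegree_eq_of_degree_eq_some (by
    rw [degree_add_eq_left_of_degree_lt (by rwa [degree_X_pow]), degree_X_pow])
  have hcoeff : ∀ j < d, p₁.coeff j = b j := fun j hj => by
    simp [p₁, coeff_X_pow, hj.ne, Finset.sum_ite_eq, hj]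
  refine ⟨d - j₀, hq, PowerSeries.X ^ v j₀, p₁, hp₁, hp₁d, ?_, ⟨j₀, hj₀d, ?_⟩, ?_⟩
  · rw [hcoeff _ (by omega)]
    have := hb (d - 1) (by omega)
    rw [hnext, map_zero, eq_comm, mul_eq_zero] at this
    rw [this.resolve_left (pow_ne_zero _ PowerSeries.X_ne_zero), map_zero]
  · rw [hcoeff _ hj₀d]
    intro h0
    have h1 := congrArg PowerSeries.order (hb j₀ hj₀d)
    rw [PowerSeries.order_expand, hv _ hj₀0, PowerSeries.order_mul, PowerSeries.order_X_pow,
      nsmul_eq_mul, mul_comm] at h1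
    have h2 : ((1 : ℕ) : ℕ∞) ≤ (b j₀).order := by
      rw [← X_pow_dvd_iff_le_order, pow_one, PowerSeries.X_dvd_iff]
      exact h0
    rw [Nat.cast_one] at h2
    have h3 : ((v j₀ * (d - j₀) : ℕ) : ℕ∞) + 1 ≤ ((v j₀ * (d - j₀) : ℕ) : ℕ∞) := by
      calc _ ≤ ((v j₀ * (d - j₀) : ℕ) : ℕ∞) + (b j₀).order := by gcongr
        _ = _ := by rw [← h1]; push_cast; rfl
    have h4 : v j₀ * (d - j₀) + 1 ≤ v j₀ * (d - j₀) := by exact_mod_cast h3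
    omega
  · ext1 j
    rw [coeff_map, coeff_scaleRoots, hp₁d]
    rcases lt_trichotomy j d with hj | hj | hj
    · rw [hcoeff j hj, ← pow_mul, mul_comm]
      exact hb j hj
    · subst hj
      have h1 : p₁.coeff d = 1 := by rw [← hp₁d]; exact hp₁.coeff_natDegree
      rw [h1, hp.coeff_natDegree, Nat.sub_self, pow_zero, mul_one, map_one]
    · rw [coeff_eq_zero_of_natDegree_lt (hp₁d.trans_lt hj), coeff_eq_zero_of_natDegree_lt hj,
        map_zero, zero_mul]

theorem coeff_taylor_pred {A : Type*} [CommRing A] {p : A[X]} (hp : p.Monic)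
    (hd : p.natDegree ≠ 0) (r : A) :
    (taylor r p).coeff (p.natDegree - 1) = p.coeff (p.natDegree - 1) + p.natDegree * r := by
  obtain ⟨d, hd'⟩ := Nat.exists_eq_succ_of_ne_zero hd
  have h1 : (hasseDeriv d p).natDegree ≤ 1 := by
    refine (natDegree_hasseDeriv_le p d).trans ?_
    omega
  have h2 : p.coeff (1 + d) = 1 := by
    rw [add_comm, ← Nat.succ_eq_add_one, ← hd']; exact hp
  rw [taylor_coeff, hd', Nat.succ_sub_one, eval_eq_sum_range' (n := 2) (by omega)]
  simp only [Finset.sum_range_succ, Finset.sum_range_zero, hasseDeriv_coeff, h2]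
  simp [add_comm 1 d]

/-- The Newton–Puiseux theorem: over an algebraically closed field of characteristic zero, a monic
polynomial over the power series in one variable splits after a substitution `X ↦ X ^ q`. -/
theorem exists_expand_splits [IsAlgClosed k] [CharZero k] (d : ℕ) :
    ∀ p : (PowerSeries k)[X], p.Monic → p.natDegree = d → ∃ (q : ℕ) (hq : q ≠ 0),
      (p.map (PowerSeries.expand q hq : PowerSeries k →ₐ[k] PowerSeries k).toRingHom).Splits := by
  induction d using Nat.strong_induction_on with
  | _ d ih =>
  have hcomp : ∀ (q r : ℕ) (hq : q ≠ 0) (hr : r ≠ 0),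
      (PowerSeries.expand q hq : PowerSeries k →ₐ[k] PowerSeries k).toRingHom.comp
        (PowerSeries.expand r hr : PowerSeries k →ₐ[k] PowerSeries k).toRingHom =
      (PowerSeries.expand (q * r) (mul_ne_zero hq hr) :
        PowerSeries k →ₐ[k] PowerSeries k).toRingHom := fun q r hq hr =>
    RingHom.ext fun f => (PowerSeries.expand_mul q hq r hr f).symm
  -- translating by `r` reduces `p` to `taylor r p`
  have htrans : ∀ (p : (PowerSeries k)[X]) (r : PowerSeries k), (∃ (q : ℕ) (hq : q ≠ 0),
      ((taylor r p).map
        (PowerSeries.expand q hq : PowerSeries k →ₐ[k] PowerSeries k).toRingHom).Splits) →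
      ∃ (q : ℕ) (hq : q ≠ 0),
        (p.map (PowerSeries.expand q hq : PowerSeries k →ₐ[k] PowerSeries k).toRingHom).Splits := by
    rintro p r ⟨q, hq, h⟩
    refine ⟨q, hq, ?_⟩
    have h1 : p = taylor (-r) (taylor r p) := by rw [taylor_taylor]; simp
    rw [h1, map_taylor]
    exact h.taylor _
  intro p hp hpd
  by_cases hd : d ≤ 1
  · exact ⟨1, one_ne_zero, .of_natDegree_le_one_of_monic
      ((natDegree_map_le).trans (hpd.trans_le hd)) (hp.map _)⟩
  have hdk : (d : k) ≠ 0 := by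
    rw [Nat.cast_ne_zero]; omega
  -- translate the roots so that their sum is zero
  refine htrans p (-(PowerSeries.C ((d : k)⁻¹) * p.coeff (d - 1))) ?_
  set p' := taylor (-(PowerSeries.C ((d : k)⁻¹) * p.coeff (d - 1))) p with hp'
  have hp'm : p'.Monic := by rw [hp', Monic, leadingCoeff_taylor]; exact hp
  have hp'd : p'.natDegree = d := by rw [hp', natDegree_taylor, hpd]
  have hp'n : p'.coeff (p'.natDegree - 1) = 0 := by
    have := coeff_taylor_pred hp (by omega) (-(PowerSeries.C ((d : k)⁻¹) * p.coeff (d - 1)))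
    rw [hpd] at this
    rw [hp'd, hp', this]
    have h1 : ((d : ℕ) : PowerSeries k) * PowerSeries.C ((d : k)⁻¹) = 1 := by
      rw [← map_natCast (PowerSeries.C (R := k)), ← map_mul, mul_inv_cancel₀ hdk, map_one]
    rw [mul_neg, ← mul_assoc, h1, one_mul, add_neg_cancel]
  by_cases hX : p' = X ^ p'.natDegree
  · refine ⟨1, one_ne_zero, ?_⟩
    rw [hX, Polynomial.map_pow, map_X]
    exact .X_pow _
  obtain ⟨q₀, hq₀, s, p₁, hp₁, hp₁d, hp₁n, ⟨j, hj, hp₁j⟩, hs⟩ :=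
    exists_expand_eq_scaleRoots hp'm hX hp'n
  rw [hp'd] at hp₁d hj hp₁n
  suffices ∃ (q : ℕ) (hq : q ≠ 0),
      (p₁.map (PowerSeries.expand q hq : PowerSeries k →ₐ[k] PowerSeries k).toRingHom).Splits by
    obtain ⟨q, hq, h⟩ := this
    refine ⟨q * q₀, mul_ne_zero hq hq₀, ?_⟩
    rw [← hcomp q q₀ hq hq₀, ← Polynomial.map_map, hs, map_scaleRoots _ _ _ (by simp [hp₁])]
    exact h.scaleRoots _
  -- The reduction of `p₁` has root sum zero and is not `X ^ d`, so it has two different roots and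
  -- `p₁` factors.
  have hmem : ∀ f : PowerSeries k, f ∈ IsLocalRing.maximalIdeal (PowerSeries k) ↔
      PowerSeries.constantCoeff f = 0 := fun f => by
    rw [IsLocalRing.mem_maximalIdeal, mem_nonunits_iff, PowerSeries.isUnit_iff_constantCoeff,
      isUnit_iff_ne_zero, not_not]
  obtain ⟨c, hc⟩ := IsAlgClosed.exists_root (p₁.map (PowerSeries.constantCoeff (R := k)))
    (by rw [hp₁.degree_map, degree_eq_natDegree hp₁.ne_zero, hp₁d]; exact_mod_cast (by omega))
  refine htrans p₁ (PowerSeries.C c) ?_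
  set p₂ := taylor (PowerSeries.C c) p₁ with hp₂
  have hp₂m : p₂.Monic := by rw [hp₂, Monic, leadingCoeff_taylor]; exact hp₁
  have hp₂d : p₂.natDegree = d := by rw [hp₂, natDegree_taylor, hp₁d]
  have hmap : p₂.map (PowerSeries.constantCoeff (R := k)) =
      taylor c (p₁.map (PowerSeries.constantCoeff (R := k))) := by
    rw [hp₂, map_taylor, PowerSeries.constantCoeff_C]
  have h0 : p₂.coeff 0 ∈ IsLocalRing.maximalIdeal (PowerSeries k) := by
    rw [hmem, ← coeff_map, hmap, taylor_coeff_zero]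
    exact hc
  obtain ⟨i, hi, hp₂i⟩ : ∃ i < d, p₂.coeff i ∉ IsLocalRing.maximalIdeal (PowerSeries k) := by
    by_contra! hall
    have h1 : p₂.map (PowerSeries.constantCoeff (R := k)) = X ^ d := by
      ext i
      rw [coeff_map, coeff_X_pow]
      rcases lt_trichotomy i d with hi | hi | hi
      · rw [if_neg hi.ne, (hmem _).mp (hall i hi)]
      · rw [if_pos hi, hi, ← hp₂d, hp₂m.coeff_natDegree, map_one]
      · rw [if_neg hi.ne', coeff_eq_zero_of_natDegree_lt (hp₂d.trans_lt hi), map_zero]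
    have h2 : p₁.map (PowerSeries.constantCoeff (R := k)) = taylor (-c) (X ^ d) := by
      rw [← h1, hmap, taylor_taylor]; simp
    have h3 := coeff_taylor_pred (monic_X_pow (R := k) d) (by rw [natDegree_X_pow]; omega) (-c)
    rw [natDegree_X_pow, ← h2, coeff_map, hp₁n, coeff_X_pow, if_neg (by omega), zero_add, eq_comm,
      mul_eq_zero, neg_eq_zero, or_iff_right hdk] at h3
    rw [h3, neg_zero, taylor_zero] at h2
    have h4 := congrArg (fun f => coeff f j) h2
    simp only [coeff_map, coeff_X_pow, if_neg hj.ne] at h4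
    exact hp₁j h4
  obtain ⟨f, g, hf, hg, hfg, hfd, hgd⟩ :=
    exists_monic_factor_of_residue_root hp₂m h0 (hi.trans_eq hp₂d.symm) hp₂i
  rw [hp₂d] at hfd hgd
  obtain ⟨q₁, hq₁, h₁⟩ := ih _ hfd f hf rfl
  obtain ⟨q₂, hq₂, h₂⟩ := ih _ hgd g hg rfl
  refine ⟨q₁ * q₂, mul_ne_zero hq₁ hq₂, ?_⟩
  rw [hfg, Polynomial.map_mul]
  refine .mul ?_ ?_
  · have := h₁.map (PowerSeries.expand q₂ hq₂ : PowerSeries k →ₐ[k] PowerSeries k).toRingHom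
    rw [Polynomial.map_map, hcomp] at this
    simpa only [mul_comm q₂ q₁] using this
  · have := h₂.map (PowerSeries.expand q₁ hq₁ : PowerSeries k →ₐ[k] PowerSeries k).toRingHom
    rwa [Polynomial.map_map, hcomp] at this

theorem ofPowerSeries_coeff_eq_zero {A : Type*} [Semiring A] (f : PowerSeries A) {r : ℚ}
    (hr : ∀ j : ℕ, (j : ℚ) ≠ r) : (HahnSeries.ofPowerSeries ℚ A f).coeff r = 0 := by
  rw [HahnSeries.ofPowerSeries_apply]
  apply HahnSeries.embDomain_of_notMem_range
  rintro ⟨j, hj⟩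
  exact hr j (by simpa using hj)

theorem splits_map_ofPowerSeries [IsAlgClosed k] [CharZero k] {p : (PowerSeries k)[X]}
    (hp : p.Monic) : (p.map (HahnSeries.ofPowerSeries ℚ k)).Splits := by
  obtain ⟨q, hq, h⟩ := exists_expand_splits _ p hp rfl
  have hq' : (q : ℚ) ≠ 0 := by exact_mod_cast hq
  have hq'' : (0 : ℚ) < q := by positivity
  -- the automorphism `t ↦ t ^ (1 / q)` of the Hahn series field
  let e : HahnSeries ℚ k →+* HahnSeries ℚ k :=
    HahnSeries.embDomainRingHom (AddMonoidHom.mulLeft ((q : ℚ)⁻¹))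
      (mul_right_injective₀ (inv_ne_zero hq'))
      (fun a b => mul_le_mul_iff_right₀ (inv_pos.mpr hq''))
  have he : (e.comp (HahnSeries.ofPowerSeries ℚ k)).comp
      (PowerSeries.expand q hq : PowerSeries k →ₐ[k] PowerSeries k).toRingHom =
        HahnSeries.ofPowerSeries ℚ k := by
    ext f r
    have h1 : (e (HahnSeries.ofPowerSeries ℚ k (PowerSeries.expand q hq f))).coeff r =
        (HahnSeries.ofPowerSeries ℚ k (PowerSeries.expand q hq f)).coeff (q * r) := by
      have h2 : r = (q : ℚ)⁻¹ * (q * r) := by field_simp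
      conv_lhs => rw [h2]
      exact HahnSeries.embDomain_coeff
    refine h1.trans ?_
    by_cases hr : ∃ j : ℕ, (j : ℚ) = r
    · obtain ⟨j, rfl⟩ := hr
      rw [← Nat.cast_mul, HahnSeries.ofPowerSeries_apply_coeff,
        HahnSeries.ofPowerSeries_apply_coeff, PowerSeries.coeff_expand_mul]
    · push Not at hr
      rw [ofPowerSeries_coeff_eq_zero f hr]
      by_cases hqr : ∃ j : ℕ, (j : ℚ) = q * r
      · obtain ⟨j, hj⟩ := hqr
        rw [← hj, HahnSeries.ofPowerSeries_apply_coeff, PowerSeries.coeff_expand_of_not_dvd]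
        rintro ⟨i, rfl⟩
        rw [Nat.cast_mul, mul_right_inj' hq'] at hj
        exact hr i hj
      · push Not at hqr
        exact ofPowerSeries_coeff_eq_zero _ hqr
  rw [← he, ← Polynomial.map_map]
  exact h.map _

end Puiseux

/-! ### Expansion in powers of one variable -/

variable {K : Type*} [Field K] {n : ℕ}

open Classical in
/-- The part of `f` of degree `j` in the variable `X_l`. -/
def slicePart (l : Fin n) (j : ℕ) (f : MvPowerSeries (Fin n) K) : MvPowerSeries (Fin n) K :=
  fun m => if m l = j then MvPowerSeries.coeff m f else 0

open Classical in
theorem coeff_slicePart (l : Fin n) (j : ℕ) (f : MvPowerSeries (Fin n) K) (m : Fin n →₀ ℕ) :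
    MvPowerSeries.coeff m (slicePart l j f) = if m l = j then MvPowerSeries.coeff m f else 0 :=
  rfl

/-- The expansion of a power series in powers of the variable `X_l`. The coefficient of `t ^ j` is
the part of degree `j` in `X_l` and still contains the factor `X_l ^ j`, so that the coefficients
can be kept in the ring of power series in all variables. -/
def slice (l : Fin n) : MvPowerSeries (Fin n) K →+* PowerSeries (MvPowerSeries (Fin n) K) where
  toFun f := PowerSeries.mk fun j => slicePart l j f
  map_zero' := by
    ext j m
    rw [PowerSeries.coeff_mk, coeff_slicePart]
    simp
  map_one' := by
    ext j m
    rw [PowerSeries.coeff_mk, PowerSeries.coeff_one, coeff_slicePart]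
    by_cases hm : m = 0
    · subst hm
      by_cases hj : j = 0
      · subst hj; simp
      · simp [hj, Ne.symm hj]
    · by_cases hj : j = 0 <;> simp [MvPowerSeries.coeff_one, hm, hj]
  map_add' f g := by
    ext j m
    rw [map_add, map_add]
    simp only [PowerSeries.coeff_mk, coeff_slicePart]
    split_ifs <;> simp
  map_mul' f g := by
    classical
    ext j m
    rw [PowerSeries.coeff_mul, map_sum]
    simp only [PowerSeries.coeff_mk, MvPowerSeries.coeff_mul, coeff_slicePart]
    rw [Finset.sum_comm]
    rw [show (if m l = j then ∑ p ∈ Finset.HasAntidiagonal.antidiagonal m,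
        MvPowerSeries.coeff p.1 f * MvPowerSeries.coeff p.2 g else 0) =
      ∑ p ∈ Finset.HasAntidiagonal.antidiagonal m, if m l = j then
        MvPowerSeries.coeff p.1 f * MvPowerSeries.coeff p.2 g else 0 by split_ifs <;> simp]
    refine Finset.sum_congr rfl fun p hp => ?_
    rw [Finset.HasAntidiagonal.mem_antidiagonal] at hp
    have hm : m l = p.1 l + p.2 l := by rw [← hp]; rfl
    split_ifs with h
    · rw [Finset.sum_eq_single (p.1 l, p.2 l)]
      · simp
      · rintro ⟨a, b⟩ - hab
        by_cases h1 : p.1 l = a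
        · by_cases h2 : p.2 l = b
          · exact absurd (by rw [h1, h2]) hab
          · simp [h2]
        · simp [h1]
      · intro h1
        exact absurd (Finset.HasAntidiagonal.mem_antidiagonal.mpr (hm.symm.trans h)) h1
    · refine (Finset.sum_eq_zero fun q hq => ?_).symm
      rw [Finset.HasAntidiagonal.mem_antidiagonal] at hq
      by_cases h1 : p.1 l = q.1
      · have h2 : p.2 l ≠ q.2 := fun h2 => h (by rw [hm, h1, h2, hq])
        simp [h2]
      · simp [h1]

theorem coeff_coeff_slice (l : Fin n) (f : MvPowerSeries (Fin n) K) (j : ℕ) (m : Fin n →₀ ℕ) :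
    MvPowerSeries.coeff m (PowerSeries.coeff j (slice l f)) =
      if m l = j then MvPowerSeries.coeff m f else 0 := by
  classical
  simp only [slice, RingHom.coe_mk, MonoidHom.coe_mk, OneHom.coe_mk, PowerSeries.coeff_mk,
    coeff_slicePart]

variable (K n) in
/-- An algebraic closure of the field of fractions of `K[[X_1, …, X_n]]`. -/
abbrev SeriesClosure : Type _ := AlgebraicClosure (FractionRing (MvPowerSeries (Fin n) K))

/-- The expansion in powers of `X_l`, as a series with rational exponents over `SeriesClosure K n`.
The coefficient field is large enough for all monic polynomials over `K[[X]]` to split. -/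
def toHahn (l : Fin n) : MvPowerSeries (Fin n) K →+* HahnSeries ℚ (SeriesClosure K n) :=
  (HahnSeries.ofPowerSeries ℚ (SeriesClosure K n)).comp
    ((PowerSeries.map (algebraMap (MvPowerSeries (Fin n) K) (SeriesClosure K n))).comp (slice l))

theorem algebraMap_seriesClosure_injective :
    Function.Injective (algebraMap (MvPowerSeries (Fin n) K) (SeriesClosure K n)) := by
  rw [IsScalarTower.algebraMap_eq (MvPowerSeries (Fin n) K)
    (FractionRing (MvPowerSeries (Fin n) K)) (SeriesClosure K n), RingHom.coe_comp]
  exact (FaithfulSMul.algebraMap_injective _ _).comp (IsFractionRing.injective _ _)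

theorem toHahn_coeff_natCast (l : Fin n) (f : MvPowerSeries (Fin n) K) (j : ℕ) :
    (toHahn l f).coeff (j : ℚ) = algebraMap _ _ (PowerSeries.coeff j (slice l f)) := by
  simp [toHahn, HahnSeries.ofPowerSeries_apply_coeff]

theorem toHahn_coeff_eq_zero (l : Fin n) (f : MvPowerSeries (Fin n) K) {r : ℚ}
    (hr : ∀ j : ℕ, (j : ℚ) ≠ r) : (toHahn l f).coeff r = 0 :=
  ofPowerSeries_coeff_eq_zero _ hr

/-- The order of `toHahn l f` is the order of `f` in `X_l`. -/
theorem le_orderTop_toHahn_iff (l : Fin n) (f : MvPowerSeries (Fin n) K) (c : ℚ) :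
    (c : WithTop ℚ) ≤ (toHahn l f).orderTop ↔
      ∀ m, MvPowerSeries.coeff m f ≠ 0 → c ≤ m l := by
  rw [HahnSeries.le_orderTop_iff_forall]
  constructor
  · intro h m hm
    by_contra hc
    rw [not_le] at hc
    have h1 := h (m l : ℚ) (by exact_mod_cast hc)
    rw [toHahn_coeff_natCast, map_eq_zero_iff _ algebraMap_seriesClosure_injective] at h1
    have h2 := coeff_coeff_slice l f (m l) m
    rw [h1, if_pos rfl, map_zero] at h2
    exact hm h2.symm
  · intro h r hr
    by_cases hj : ∃ j : ℕ, (j : ℚ) = r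
    · obtain ⟨j, rfl⟩ := hj
      rw [toHahn_coeff_natCast, map_eq_zero_iff _ algebraMap_seriesClosure_injective]
      ext m
      rw [coeff_coeff_slice, map_zero]
      split_ifs with hm
      · by_contra hne
        have := h m hne
        rw [hm] at this
        exact absurd hr (not_lt.mpr (by exact_mod_cast this))
      · rfl
    · push Not at hj
      exact toHahn_coeff_eq_zero _ _ hj

theorem le_of_coeff_pow_ne_zero {f : MvPowerSeries (Fin n) K} {l : Fin n} {c : ℚ}
    (hf : ∀ m, MvPowerSeries.coeff m f ≠ 0 → c ≤ m l) (k : ℕ) {m : Fin n →₀ ℕ}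
    (hm : MvPowerSeries.coeff m (f ^ k) ≠ 0) : k * c ≤ m l := by
  have h1 : (c : WithTop ℚ) ≤ (toHahn l f).orderTop := (le_orderTop_toHahn_iff l f c).mpr hf
  refine (le_orderTop_toHahn_iff l (f ^ k) _).mp ?_ m hm
  rw [map_pow]
  clear hm
  induction k with
  | zero => simp
  | succ k ih =>
    rw [pow_succ, HahnSeries.orderTop_mul, Nat.cast_succ, add_mul, one_mul, WithTop.coe_add]
    exact add_le_add ih h1

theorem toHahn_injective (l : Fin n) : Function.Injective (toHahn (K := K) l) := by
  rw [injective_iff_map_eq_zero]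
  intro f hf
  ext m
  by_contra hm
  have := (le_orderTop_toHahn_iff l f (m l + 1)).mp (by simp [hf]) m hm
  linarith

/-! ### Derivations -/

/-- The derivation `X_i ∂/∂X_i` of `K[[X]]`. -/
def eulerDerivation (i : Fin n) :
    Derivation K (MvPowerSeries (Fin n) K) (MvPowerSeries (Fin n) K) :=
  (MvPowerSeries.X i : MvPowerSeries (Fin n) K) • MvPowerSeries.pderiv K i

theorem coeff_eulerDerivation (i : Fin n) (f : MvPowerSeries (Fin n) K) (m : Fin n →₀ ℕ) :
    MvPowerSeries.coeff m (eulerDerivation i f) = m i * MvPowerSeries.coeff m f := by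
  classical
  change MvPowerSeries.coeff m (MvPowerSeries.X i * MvPowerSeries.pderiv K i f) = _
  by_cases hm : m i = 0
  · rw [hm, Nat.cast_zero, zero_mul]
    exact (MvPowerSeries.X_dvd_iff.mp (dvd_mul_right _ _)) m hm
  · have h1 : m = Finsupp.single i 1 + (m - Finsupp.single i 1) := by
      rw [add_tsub_cancel_of_le]
      rwa [Finsupp.single_le_iff, Nat.one_le_iff_ne_zero]
    conv_lhs => rw [h1]
    rw [MvPowerSeries.X, MvPowerSeries.coeff_add_monomial_mul, one_mul, MvPowerSeries.coeff_pderiv]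
    rw [add_comm] at h1
    rw [← h1, mul_comm]
    congr 1
    have h2 : (m - Finsupp.single i 1 : Fin n →₀ ℕ) i + 1 = m i := by
      rw [Finsupp.tsub_apply, Finsupp.single_eq_same]; omega
    rw [← Nat.cast_succ, Nat.succ_eq_add_one, h2]

theorem coeff_slice_eulerDerivation (l i : Fin n) (f : MvPowerSeries (Fin n) K) (j : ℕ) :
    PowerSeries.coeff j (slice l (eulerDerivation i f)) =
      eulerDerivation i (PowerSeries.coeff j (slice l f)) := by
  ext m
  simp only [coeff_coeff_slice, coeff_eulerDerivation]
  split_ifs <;> simp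

theorem coeff_slice_eulerDerivation_self (l : Fin n) (f : MvPowerSeries (Fin n) K) (j : ℕ) :
    PowerSeries.coeff j (slice l (eulerDerivation l f)) = j * PowerSeries.coeff j (slice l f) := by
  ext m
  rw [← nsmul_eq_mul, map_nsmul]
  simp only [coeff_coeff_slice, coeff_eulerDerivation]
  split_ifs with h <;> simp [h]

/-- The additive map `∑ x_r t ^ r ↦ ∑ (D x_r + c r x_r) t ^ r`, a derivation if `D` is one.
For `D = 0` and `c r = r` it is `t d/dt`. -/
def gradedDerivation {A : Type*} [CommRing A] (D : A →+ A) (c : ℚ →+ A) :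
    HahnSeries ℚ A →+ HahnSeries ℚ A where
  toFun x := ⟨fun r => D (x.coeff r) + c r * x.coeff r,
    x.isPWO_support.mono fun r hr h => hr (by
      simp only [h, map_zero, mul_zero, add_zero])⟩
  map_zero' := by
    ext r
    simp
  map_add' x y := by
    ext r
    simp only [HahnSeries.coeff_add, map_add]
    ring

theorem coeff_gradedDerivation {A : Type*} [CommRing A] (D : A →+ A) (c : ℚ →+ A)
    (x : HahnSeries ℚ A) (r : ℚ) :
    (gradedDerivation D c x).coeff r = D (x.coeff r) + c r * x.coeff r := rfl

theorem gradedDerivation_mul {A : Type*} [CommRing A] {D : A →+ A}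
    (hD : ∀ a b, D (a * b) = a * D b + b * D a) (c : ℚ →+ A) (x y : HahnSeries ℚ A) :
    gradedDerivation D c (x * y) = x * gradedDerivation D c y + y * gradedDerivation D c x := by
  have hsupp : ∀ z : HahnSeries ℚ A, (gradedDerivation D c z).support ⊆ z.support :=
    fun z r hr h => hr (by
      rw [coeff_gradedDerivation, h, map_zero, mul_zero, add_zero])
  ext r
  rw [mul_comm y, HahnSeries.coeff_add, HahnSeries.coeff_mul_right' y.isPWO_support (hsupp y),
    HahnSeries.coeff_mul_left' x.isPWO_support (hsupp x), coeff_gradedDerivation,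
    HahnSeries.coeff_mul, map_sum, Finset.mul_sum, ← Finset.sum_add_distrib,
    ← Finset.sum_add_distrib]
  refine Finset.sum_congr rfl fun p hp => ?_
  have hp : p.1 + p.2 = r := (Finset.mem_antidiagonal.mp hp).2.2
  rw [hD, coeff_gradedDerivation, coeff_gradedDerivation, ← hp, map_add]
  ring

theorem orderTop_le_orderTop_gradedDerivation {A : Type*} [CommRing A] (D : A →+ A)
    (c : ℚ →+ A) (x : HahnSeries ℚ A) : x.orderTop ≤ (gradedDerivation D c x).orderTop := by
  rw [HahnSeries.le_orderTop_iff_forall]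
  intro r hr
  rw [coeff_gradedDerivation, HahnSeries.coeff_eq_zero_of_lt_orderTop hr, map_zero, mul_zero,
    add_zero]

instance [CharZero K] : CharZero (MvPowerSeries (Fin n) K) :=
  charZero_of_injective_algebraMap (FaithfulSMul.algebraMap_injective K (MvPowerSeries (Fin n) K))

instance [CharZero K] : CharZero (FractionRing (MvPowerSeries (Fin n) K)) :=
  charZero_of_injective_algebraMap (IsFractionRing.injective (MvPowerSeries (Fin n) K) _)

instance [CharZero K] : CharZero (SeriesClosure K n) :=
  charZero_of_injective_algebraMap
    (FaithfulSMul.algebraMap_injective (FractionRing (MvPowerSeries (Fin n) K)) _)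

/-- A derivation of `K[[X]]` extends to the algebraic closure of its field of fractions, because
this extension is formally étale in characteristic zero. -/
theorem exists_derivation_seriesClosure [CharZero K]
    (d : Derivation K (MvPowerSeries (Fin n) K) (MvPowerSeries (Fin n) K)) :
    ∃ D : Derivation K (SeriesClosure K n) (SeriesClosure K n),
      ∀ f, D (algebraMap _ _ f) = algebraMap _ _ (d f) := by
  have h1 : Algebra.FormallyEtale (MvPowerSeries (Fin n) K)
      (FractionRing (MvPowerSeries (Fin n) K)) :=
    Algebra.FormallyEtale.of_isLocalization (nonZeroDivisors (MvPowerSeries (Fin n) K))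
  have h2 : Algebra.FormallyEtale (FractionRing (MvPowerSeries (Fin n) K)) (SeriesClosure K n) :=
    Algebra.FormallyEtale.of_isSeparable _ _
  have h3 : Algebra.FormallyEtale (MvPowerSeries (Fin n) K) (SeriesClosure K n) :=
    .comp _ (FractionRing (MvPowerSeries (Fin n) K)) _
  let e := KaehlerDifferential.tensorKaehlerEquivOfFormallyEtale K (MvPowerSeries (Fin n) K)
    (SeriesClosure K n)
  let φ : TensorProduct (MvPowerSeries (Fin n) K) (SeriesClosure K n)
      (Ω[MvPowerSeries (Fin n) K⁄K]) →ₗ[SeriesClosure K n] SeriesClosure K n :=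
    LinearMap.liftBaseChange _ ((Algebra.linearMap _ _).comp d.liftKaehlerDifferential)
  refine ⟨(φ.comp e.symm.toLinearMap).compDer (KaehlerDifferential.D K _), fun f => ?_⟩
  have h4 := KaehlerDifferential.tensorKaehlerEquivOfFormallyEtale_symm_D_algebraMap K
    (MvPowerSeries (Fin n) K) (SeriesClosure K n) f
  change φ (e.symm (KaehlerDifferential.D K _ (algebraMap _ _ f))) = _
  rw [h4, LinearMap.liftBaseChange_tmul, one_smul, LinearMap.comp_apply,
    Derivation.liftKaehlerDifferential_comp_D]
  rfl

theorem gradedDerivation_toHahn (l i : Fin n) {D : SeriesClosure K n →+ SeriesClosure K n}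
    (hD : ∀ f : MvPowerSeries (Fin n) K,
      D (algebraMap _ _ f) = algebraMap _ _ (eulerDerivation i f))
    (f : MvPowerSeries (Fin n) K) :
    gradedDerivation D 0 (toHahn l f) = toHahn l (eulerDerivation i f) := by
  ext r
  rw [coeff_gradedDerivation, AddMonoidHom.zero_apply, zero_mul, add_zero]
  by_cases hj : ∃ j : ℕ, (j : ℚ) = r
  · obtain ⟨j, rfl⟩ := hj
    rw [toHahn_coeff_natCast, toHahn_coeff_natCast, hD, coeff_slice_eulerDerivation]
  · push Not at hj
    rw [toHahn_coeff_eq_zero _ _ hj, toHahn_coeff_eq_zero _ _ hj, map_zero]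

theorem gradedDerivation_zero_toHahn [CharZero K] (l : Fin n) (f : MvPowerSeries (Fin n) K) :
    gradedDerivation 0 (algebraMap ℚ (SeriesClosure K n) : ℚ →+ SeriesClosure K n) (toHahn l f) =
      toHahn l (eulerDerivation l f) := by
  ext r
  rw [coeff_gradedDerivation, AddMonoidHom.zero_apply, zero_add]
  by_cases hj : ∃ j : ℕ, (j : ℚ) = r
  · obtain ⟨j, rfl⟩ := hj
    rw [toHahn_coeff_natCast, toHahn_coeff_natCast, coeff_slice_eulerDerivation_self, map_mul]
    congr 1
    exact (map_natCast (algebraMap ℚ (SeriesClosure K n)) j).trans (map_natCast _ j).symm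
  · push Not at hj
    rw [toHahn_coeff_eq_zero _ _ hj, toHahn_coeff_eq_zero _ _ hj, mul_zero]

/-- The polynomial obtained from `p` by applying `d` to the coefficients. -/
def coeffwise {A : Type*} [Semiring A] (d : A →+ A) (p : A[X]) : A[X] :=
  p.sum fun k a => monomial k (d a)

/-- The derivative of `p(x)`, for a derivation `D` that restricts to `d` on coefficients. -/
theorem map_eval₂_of_leibniz {A B : Type*} [CommRing A] [CommRing B] (φ : A →+* B) (d : A →+ A)
    (D : B →+ B) (hD : ∀ a b, D (a * b) = a * D b + b * D a) (hφ : ∀ a, D (φ a) = φ (d a))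
    (p : A[X]) (x : B) :
    D (p.eval₂ φ x) = (coeffwise d p).eval₂ φ x + p.derivative.eval₂ φ x * D x := by
  induction p using Polynomial.induction_on' with
  | add p q hp hq =>
    have h : coeffwise d (p + q) = coeffwise d p + coeffwise d q :=
      sum_add_index _ _ _ (by simp) (by simp)
    rw [h, derivative_add]
    simp only [eval₂_add, map_add, hp, hq]
    ring
  | monomial k a =>
    have h : coeffwise d (monomial k a) = monomial k (d a) := sum_monomial_index _ _ (by simp)
    have h1 : D 1 = 0 := by simpa using hD 1 1
    have hpow : ∀ k : ℕ, D (x ^ k) = k * x ^ (k - 1) * D x := fun k => by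
      induction k with
      | zero => simp [h1]
      | succ k ih =>
        rw [pow_succ, hD, ih]
        cases k with
        | zero => simp
        | succ k => push_cast; ring
    rw [h, derivative_monomial]
    simp only [eval₂_monomial, map_mul, map_natCast]
    rw [hD, hφ, hpow]
    ring

/-! ### Orders of Hahn series, roots and coefficients -/

theorem le_orderTop_multiset_sum {k : Type*} [Field k] {c : WithTop ℚ}
    (s : Multiset (HahnSeries ℚ k)) (hs : ∀ y ∈ s, c ≤ y.orderTop) : c ≤ s.sum.orderTop := by
  induction s using Multiset.induction_on with
  | empty => simp
  | cons a s ih =>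
    rw [Multiset.sum_cons]
    exact (le_min (hs a (Multiset.mem_cons_self a s))
      (ih fun y hy => hs y (Multiset.mem_cons_of_mem hy))).trans
        HahnSeries.min_orderTop_le_orderTop_add

theorem le_orderTop_coeff_prod {k : Type*} [Field k] (c : ℚ) (s : Multiset (HahnSeries ℚ k))
    (hs : ∀ y ∈ s, (c : WithTop ℚ) ≤ y.orderTop) (j : ℕ) :
    ((((Multiset.card s : ℚ) - j) * c : ℚ) : WithTop ℚ) ≤
      ((s.map fun y => X - C y).prod.coeff j).orderTop := by
  induction s using Multiset.induction_on generalizing j with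
  | empty =>
    cases j with
    | zero => simp
    | succ j => simp [coeff_one]
  | cons a s ih =>
    have ih' := ih fun y hy => hs y (Multiset.mem_cons_of_mem hy)
    have ha := hs a (Multiset.mem_cons_self a s)
    rw [Multiset.map_cons, Multiset.prod_cons, Multiset.card_cons,
      sub_mul (X : (HahnSeries ℚ k)[X]), coeff_sub, coeff_C_mul]
    have h2 : ((((Multiset.card s + 1 : ℕ) : ℚ) - j) * c : ℚ) ≤
        (a * (s.map fun y => X - C y).prod.coeff j).orderTop := by
      have h3 : (((((Multiset.card s + 1 : ℕ) : ℚ) - j) * c : ℚ) : WithTop ℚ) =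
          (c : WithTop ℚ) + ((((Multiset.card s : ℚ) - j) * c : ℚ) : WithTop ℚ) := by
        rw [← WithTop.coe_add]; congr 1; push_cast; ring
      rw [HahnSeries.orderTop_mul, h3]
      exact add_le_add ha (ih' j)
    refine le_trans (le_min ?_ h2) HahnSeries.min_orderTop_le_orderTop_sub
    cases j with
    | zero => simp
    | succ j =>
      rw [coeff_X_mul]
      convert ih' j using 2
      push_cast; ring

/-! ### Places over the coordinate hyperplanes -/

theorem constantCoeff_eq_zero_of_orderTop_pos (l : Fin n) {f : MvPowerSeries (Fin n) K}
    (hf : 0 < (toHahn l f).orderTop) : MvPowerSeries.constantCoeff f = 0 := by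
  have h1 := HahnSeries.coeff_eq_zero_of_lt_orderTop (i := ((0 : ℕ) : ℚ)) (x := toHahn l f)
    (by rw [Nat.cast_zero]; exact hf)
  rw [toHahn_coeff_natCast, map_eq_zero_iff _ algebraMap_seriesClosure_injective] at h1
  have h2 := coeff_coeff_slice l f 0 0
  rw [h1, map_zero] at h2
  simpa using h2.symm

theorem orderTop_eval₂_nonneg (l : Fin n) (p : (MvPowerSeries (Fin n) K)[X])
    {y : HahnSeries ℚ (SeriesClosure K n)} (hy : 0 ≤ y.orderTop) :
    0 ≤ (p.eval₂ (toHahn l) y).orderTop := by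
  induction p using Polynomial.induction_on' with
  | add p q hp hq =>
    rw [eval₂_add]
    exact (le_min hp hq).trans HahnSeries.min_orderTop_le_orderTop_add
  | monomial k a =>
    have hpow : 0 ≤ (y ^ k).orderTop := by
      induction k with
      | zero => simp
      | succ k ih => rw [pow_succ, HahnSeries.orderTop_mul]; exact add_nonneg ih hy
    have ha : 0 ≤ (toHahn l a).orderTop :=
      (le_orderTop_toHahn_iff l a 0).mpr fun m _ => Nat.cast_nonneg _
    rw [eval₂_monomial, HahnSeries.orderTop_mul]
    exact add_nonneg ha hpow

theorem orderTop_nonneg_of_monic (l : Fin n) {p : (MvPowerSeries (Fin n) K)[X]} (hp : p.Monic)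
    {y : HahnSeries ℚ (SeriesClosure K n)} (hy : p.eval₂ (toHahn l) y = 0) : 0 ≤ y.orderTop := by
  by_contra hneg
  rw [not_le] at hneg
  have hy0 : y ≠ 0 := by
    rintro rfl
    simp at hneg
  have hpos : 0 < y⁻¹.orderTop := by
    have h1 : y.orderTop + y⁻¹.orderTop = 0 := by
      rw [← HahnSeries.orderTop_mul, mul_inv_cancel₀ hy0, HahnSeries.orderTop_one]
    by_contra h2
    rw [not_lt] at h2
    refine absurd h1 (ne_of_lt ?_)
    exact (add_le_add_right h2 _).trans_lt (by rwa [add_zero])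
  let _ : Invertible y := invertibleOfNonzero hy0
  have h1 := (eval₂_reverse_eq_zero_iff (toHahn l) y p).mpr hy
  rw [invOf_eq_inv, ← divX_mul_X_add p.reverse, eval₂_add, eval₂_mul, eval₂_X, eval₂_C,
    coeff_zero_reverse, hp.leadingCoeff, map_one, add_eq_zero_iff_eq_neg] at h1
  have h2 := congrArg HahnSeries.orderTop h1
  rw [HahnSeries.orderTop_neg, HahnSeries.orderTop_one, HahnSeries.orderTop_mul] at h2
  exact absurd h2
    (hpos.trans_le (le_add_of_nonneg_left (orderTop_eval₂_nonneg l _ hpos.le))).ne'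

/-- `Ψ` is a place at `l`: an embedding of `SeriesClosure K n` into the field of series with
rational exponents that extends the expansion of power series in powers of `X_l`. The order of `Ψ ω`
is a valuation of `ω` over the divisor `X_l = 0`. -/
def IsPlace (l : Fin n) (Ψ : SeriesClosure K n →+* HahnSeries ℚ (SeriesClosure K n)) : Prop :=
  Ψ.comp (algebraMap (MvPowerSeries (Fin n) K) (SeriesClosure K n)) = toHahn l

theorem IsPlace.apply_algebraMap {l : Fin n}
    {Ψ : SeriesClosure K n →+* HahnSeries ℚ (SeriesClosure K n)} (h : IsPlace l Ψ)
    (f : MvPowerSeries (Fin n) K) : Ψ (algebraMap _ _ f) = toHahn l f :=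
  DFunLike.congr_fun h f

theorem IsPlace.apply_aeval {l : Fin n}
    {Ψ : SeriesClosure K n →+* HahnSeries ℚ (SeriesClosure K n)} (h : IsPlace l Ψ)
    (p : (MvPowerSeries (Fin n) K)[X]) (x : SeriesClosure K n) :
    Ψ (aeval x p) = p.eval₂ (toHahn l) (Ψ x) := by
  rw [aeval_def, hom_eval₂, h]

theorem IsPlace.orderTop_nonneg {l : Fin n}
    {Ψ : SeriesClosure K n →+* HahnSeries ℚ (SeriesClosure K n)} (h : IsPlace l Ψ)
    {ω : SeriesClosure K n} (hω : IsIntegral (MvPowerSeries (Fin n) K) ω) :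
    0 ≤ (Ψ ω).orderTop := by
  refine orderTop_nonneg_of_monic l (minpoly.monic hω) ?_
  rw [← h.apply_aeval, minpoly.aeval, map_zero]

section CharZero
variable [CharZero K]

/-- By the Newton–Puiseux theorem over the coefficient field `SeriesClosure K n`. -/
theorem splits_map_toHahn (l : Fin n) {p : (MvPowerSeries (Fin n) K)[X]} (hp : p.Monic) :
    (p.map (toHahn l)).Splits := by
  rw [toHahn, ← Polynomial.map_map]
  exact splits_map_ofPowerSeries (hp.map _)

/-- If all monic polynomials over `R` split in `H`, then `φ : R → H` extends to an algebraic
extension `L`, and an integral element can be sent to any root of its minimal polynomial. -/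
theorem exists_ringHom_apply_eq {R L H : Type*} (F : Type*) [CommRing R] [IsDomain R]
    [IsIntegrallyClosed R] [Field F] [Algebra R F] [IsFractionRing R F] [Field L] [Algebra R L]
    [Algebra F L] [IsScalarTower R F L] [Algebra.IsAlgebraic F L] [Field H] {φ : R →+* H}
    (hφ : Function.Injective φ) (hs : ∀ p : R[X], p.Monic → (p.map φ).Splits) {θ : L}
    (hθ : IsIntegral R θ) {y : H} (hy : (minpoly R θ).eval₂ φ y = 0) :
    ∃ Ψ : L →+* H, Ψ.comp (algebraMap R L) = φ ∧ Ψ θ = y := by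
  let ι : F →+* H := IsFractionRing.lift hφ
  have hι : ι.comp (algebraMap R F) = φ :=
    RingHom.ext fun f => IsFractionRing.lift_algebraMap hφ f
  algebraize [ι]
  have hsplit : ∀ s : L, IsIntegral F s ∧ ((minpoly F s).map (algebraMap F H)).Splits := by
    intro s
    refine ⟨Algebra.IsIntegral.isIntegral s, ?_⟩
    obtain ⟨r, hr, hrs⟩ := ((IsFractionRing.isAlgebraic_iff R F L).mpr
      (Algebra.IsAlgebraic.isAlgebraic s)).exists_integral_multiple
    set p := minpoly R (r • s)
    have hr' : algebraMap R F r ≠ 0 := by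
      rwa [Ne, map_eq_zero_iff _ (IsFractionRing.injective R F)]
    have h1 : minpoly F s ∣ (p.map (algebraMap R F)).comp (C (algebraMap R F r) * X) := by
      apply minpoly.dvd
      rw [aeval_comp, map_mul, aeval_C, aeval_X, aeval_map_algebraMap,
        ← IsScalarTower.algebraMap_apply, ← Algebra.smul_def]
      exact minpoly.aeval _ _
    have h2 : ((p.map (algebraMap R F)).comp (C (algebraMap R F r) * X)).map ι =
        (p.map φ).comp (C (φ r) * X) := by
      rw [Polynomial.map_comp, Polynomial.map_map, hι, Polynomial.map_mul, map_C, map_X, ← hι]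
      rfl
    refine Splits.of_dvd (g := (p.map φ).comp (C (φ r) * X)) ?_ ?_ ?_
    · exact (hs p (minpoly.monic hrs)).comp_of_natDegree_le_one 
        (by simpa using natDegree_C_mul_le (φ r) X)
    · rw [← h2, Ne, Polynomial.map_eq_zero,
        comp_C_mul_X_eq_zero_iff (mem_nonZeroDivisors_of_ne_zero hr')]
      exact ((minpoly.monic hrs).map _).ne_zero
    · rw [← h2]
      exact Polynomial.map_dvd ι h1
  obtain ⟨ψ, hψ⟩ := IntermediateField.exists_algHom_of_splits_of_aeval (F := F)
    (E := L) (K := H) hsplit (x := θ) (y := y) (by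
      rw [minpoly.isIntegrallyClosed_eq_field_fractions' F hθ, aeval_def, eval₂_map]
      change eval₂ (ι.comp (algebraMap R F)) y _ = 0
      rw [hι]
      exact hy)
  refine ⟨ψ.toRingHom, RingHom.ext fun f => ?_, hψ⟩
  rw [← hι, RingHom.comp_apply, IsScalarTower.algebraMap_apply R F L]
  exact ψ.commutes (algebraMap R F f)

/-- Each root of the minimal polynomial in the field of series is the value at some place. -/
theorem exists_isPlace_apply_eq (l : Fin n) {θ : SeriesClosure K n}
    (hθ : IsIntegral (MvPowerSeries (Fin n) K) θ) {y : HahnSeries ℚ (SeriesClosure K n)}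
    (hy : (minpoly (MvPowerSeries (Fin n) K) θ).eval₂ (toHahn l) y = 0) :
    ∃ Ψ, IsPlace l Ψ ∧ Ψ θ = y := by
  have hs : ∀ p : (MvPowerSeries (Fin n) K)[X], p.Monic → (p.map (toHahn l)).Splits :=
    fun _ hp => splits_map_toHahn l hp
  obtain ⟨Ψ, h1, h2⟩ := exists_ringHom_apply_eq (R := MvPowerSeries (Fin n) K)
    (FractionRing (MvPowerSeries (Fin n) K)) (toHahn_injective l) hs hθ hy
  exact ⟨Ψ, h1, h2⟩

/-- An element with denominator `X ^ β` is integral over `K[[X]]` if it has no pole at any place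
over the coordinate hyperplanes: for `θ = X ^ β ω`, the Newton polygon at the places over `X_l = 0`
shows that the coefficient of `T ^ j` in the minimal polynomial of `θ` is divisible by
`X ^ ((N - j) β)`. -/
theorem isIntegral_of_orderTop_nonneg {β : Fin n →₀ ℕ} {ω : SeriesClosure K n}
    (hω : IsIntegral (MvPowerSeries (Fin n) K)
      (algebraMap (MvPowerSeries (Fin n) K) _ (MvPowerSeries.monomial β 1) * ω))
    (h : ∀ l Ψ, IsPlace l Ψ → 0 ≤ (Ψ ω).orderTop) : IsIntegral (MvPowerSeries (Fin n) K) ω := by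
  set θ := algebraMap (MvPowerSeries (Fin n) K) (SeriesClosure K n) (MvPowerSeries.monomial β 1) * ω
    with hθ
  set μ := minpoly (MvPowerSeries (Fin n) K) θ with hμ
  have hμm : μ.Monic := minpoly.monic hω
  set N := μ.natDegree with hN
  have hdvd : ∀ j < N, MvPowerSeries.monomial ((N - j) • β) (1 : K) ∣ μ.coeff j := by
    intro j hj
    rw [monomial_dvd_iff]
    intro m hm l
    have hs := splits_map_toHahn l hμm
    have hroots : ∀ y ∈ (μ.map (toHahn l)).roots, ((β l : ℚ) : WithTop ℚ) ≤ y.orderTop := by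
      intro y hy
      rw [mem_roots (hμm.map _).ne_zero, IsRoot.def, eval_map] at hy
      obtain ⟨Ψ, hΨ, rfl⟩ := exists_isPlace_apply_eq l hω hy
      rw [hθ, map_mul, hΨ.apply_algebraMap, HahnSeries.orderTop_mul]
      refine le_add_of_le_of_nonneg ((le_orderTop_toHahn_iff l _ _).mpr fun m hm => ?_) (h l Ψ hΨ)
      classical
      rw [MvPowerSeries.coeff_monomial] at hm
      rw [(ite_ne_right_iff.mp hm).1]
    have h1 := le_orderTop_coeff_prod _ _ hroots j
    rw [← hs.eq_prod_roots_of_monic (hμm.map _), coeff_map, ← hs.natDegree_eq_card_roots,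
      hμm.natDegree_map, le_orderTop_toHahn_iff] at h1
    have h2 := h1 m hm
    rw [← Nat.cast_sub hj.le] at h2
    exact_mod_cast h2
  choose! b hb using hdvd
  refine ⟨X ^ N + ∑ j ∈ Finset.range N, C (b j) * X ^ j, monic_X_pow_add ?_, ?_⟩
  · refine (degree_sum_le _ _).trans_lt ((Finset.sup_lt_iff (WithBot.bot_lt_coe _)).mpr
      fun j hj => (degree_C_mul_X_pow_le _ _).trans_lt ?_)
    exact_mod_cast Finset.mem_range.mp hj
  · have hne : algebraMap (MvPowerSeries (Fin n) K) (SeriesClosure K n)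
        (MvPowerSeries.monomial β 1) ≠ 0 := by
      rw [Ne, map_eq_zero_iff _ algebraMap_seriesClosure_injective]
      intro h0
      have := congrArg (MvPowerSeries.coeff β) h0
      simp at this
    refine (mul_eq_zero.mp (?_ : algebraMap (MvPowerSeries (Fin n) K) (SeriesClosure K n)
      (MvPowerSeries.monomial β 1) ^ N * _ = 0)).resolve_left (pow_ne_zero _ hne)
    have h1 : aeval θ μ = 0 := minpoly.aeval _ _
    rw [aeval_eq_sum_range, ← hN, Finset.sum_range_succ, hN, hμm.coeff_natDegree, one_smul,
      ← hN, hθ, mul_pow] at h1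
    rw [eval₂_add, eval₂_X_pow, eval₂_finsetSum, mul_add, Finset.mul_sum, ← h1, add_comm]
    congr 1
    refine Finset.sum_congr rfl fun j hj => ?_
    rw [Finset.mem_range] at hj
    rw [hb j hj, eval₂_mul, eval₂_C, eval₂_X_pow, Algebra.smul_def, map_mul]
    have h2 : MvPowerSeries.monomial ((N - j) • β) (1 : K) =
        MvPowerSeries.monomial β 1 ^ (N - j) := by
      rw [MvPowerSeries.monomial_pow, one_pow]
    rw [h2, map_pow, mul_pow]
    obtain ⟨i, hi⟩ := Nat.exists_eq_add_of_le hj.le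
    rw [hi, Nat.add_sub_cancel_left]
    ring
end CharZero

/-! ### Values of integral elements at places -/

theorem isIntegral_aeval {R A : Type*} [CommRing R] [CommRing A] [Algebra R A] {x : A}
    (hx : IsIntegral R x) (p : R[X]) : IsIntegral R (aeval x p) := by
  rw [aeval_eq_sum_range]
  exact IsIntegral.sum _ fun i _ => (hx.pow i).smul _

theorem exists_isPlace [CharZero K] (l : Fin n) : ∃ Ψ, IsPlace (K := K) l Ψ := by
  obtain ⟨Ψ, h, -⟩ := exists_isPlace_apply_eq (K := K) l (θ := 0) (y := 0) isIntegral_zero (by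
    have h0 := minpoly.aeval (MvPowerSeries (Fin n) K) (0 : SeriesClosure K n)
    rw [← coeff_zero_eq_aeval_zero', map_eq_zero_iff _ algebraMap_seriesClosure_injective] at h0
    rw [eval₂_eq_eval_map, ← coeff_zero_eq_eval_zero, coeff_map, h0, map_zero])
  exact ⟨Ψ, h⟩

/-- If an integral element takes a constant value `c` at one place, then by Hensel's lemma its
minimal polynomial reduces to a power of `T - c` modulo the maximal ideal. This is how information
is carried from one coordinate hyperplane to another. -/
theorem minpoly_map_constantCoeff {l : Fin n}
    {Ψ : SeriesClosure K n →+* HahnSeries ℚ (SeriesClosure K n)} (hΨ : IsPlace l Ψ)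
    {ω : SeriesClosure K n} (hω : IsIntegral (MvPowerSeries (Fin n) K) ω) (c : K)
    (hc : 0 < (Ψ (ω - algebraMap (MvPowerSeries (Fin n) K) _ (MvPowerSeries.C c))).orderTop) :
    (minpoly (MvPowerSeries (Fin n) K) ω).map MvPowerSeries.constantCoeff =
      (X - C c) ^ (minpoly (MvPowerSeries (Fin n) K) ω).natDegree := by
  set μ := minpoly (MvPowerSeries (Fin n) K) ω with hμ
  have hμm : μ.Monic := minpoly.monic hω
  set p := taylor (MvPowerSeries.C c) μ with hp
  have hpm : p.Monic := by rw [hp, Monic, leadingCoeff_taylor]; exact hμm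
  have hpd : p.natDegree = μ.natDegree := natDegree_taylor _ _
  have hpi : Irreducible p := by
    exact (MulEquiv.irreducible_iff (taylorEquiv (MvPowerSeries.C c))).mpr
      (minpoly.irreducible hω)
  set x := ω - algebraMap (MvPowerSeries (Fin n) K) _ (MvPowerSeries.C c) with hx
  have hpx : aeval x p = 0 := by
    rw [hp, taylor_apply, aeval_comp, map_add, aeval_X, aeval_C, hx, sub_add_cancel,
      minpoly.aeval]
  have h0 : p.coeff 0 ∈ IsLocalRing.maximalIdeal (MvPowerSeries (Fin n) K) := by
    rw [mem_maximalIdeal_iff]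
    refine constantCoeff_eq_zero_of_orderTop_pos l ?_
    have h1 := congrArg Ψ hpx
    rw [hΨ.apply_aeval, ← divX_mul_X_add p, eval₂_add, eval₂_mul, eval₂_X, eval₂_C, map_zero,
      add_eq_zero_iff_eq_neg'] at h1
    rw [h1, HahnSeries.orderTop_neg, HahnSeries.orderTop_mul]
    exact hc.trans_le (le_add_of_nonneg_left (orderTop_eval₂_nonneg l _ hc.le))
  have hlow : ∀ k < p.natDegree, MvPowerSeries.constantCoeff (p.coeff k) = 0 := by
    intro k hk
    rw [← mem_maximalIdeal_iff]
    by_contra hpk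
    obtain ⟨f, g, hf, hg, hfg, hfd, hgd⟩ := exists_monic_factor_of_residue_root hpm h0 hk hpk
    rcases hpi.isUnit_or_isUnit hfg with h | h
    · rw [hf.isUnit_iff] at h
      rw [hfg, h, one_mul] at hgd
      exact lt_irrefl _ hgd
    · rw [hg.isUnit_iff] at h
      rw [hfg, h, mul_one] at hfd
      exact lt_irrefl _ hfd
  have h1 : p.map MvPowerSeries.constantCoeff = X ^ p.natDegree := by
    ext k
    rw [coeff_map, coeff_X_pow]
    rcases lt_trichotomy k p.natDegree with hk | hk | hk
    · rw [if_neg hk.ne, hlow k hk]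
    · rw [if_pos hk, hk, hpm.coeff_natDegree, map_one]
    · rw [if_neg hk.ne', coeff_eq_zero_of_natDegree_lt hk, map_zero]
  have h2 : taylor (-MvPowerSeries.C c) p = μ := by rw [hp, taylor_taylor]; simp
  have h3 : taylor (-c) (X ^ μ.natDegree) = (X - C c) ^ μ.natDegree := by
    rw [taylor_X_pow, C_neg, ← sub_eq_add_neg]
  rw [← h3, ← hpd, ← h1, ← h2, map_taylor, map_neg, MvPowerSeries.constantCoeff_C]

/-- A constant value of an integral element does not depend on the place. -/
theorem eq_of_orderTop_pos {l l' : Fin n}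
    {Ψ Ψ' : SeriesClosure K n →+* HahnSeries ℚ (SeriesClosure K n)} (hΨ : IsPlace l Ψ)
    (hΨ' : IsPlace l' Ψ')
    {ω : SeriesClosure K n} (hω : IsIntegral (MvPowerSeries (Fin n) K) ω) {c c' : K}
    (hc : 0 < (Ψ (ω - algebraMap (MvPowerSeries (Fin n) K) _ (MvPowerSeries.C c))).orderTop)
    (hc' : 0 < (Ψ' (ω - algebraMap (MvPowerSeries (Fin n) K) _ (MvPowerSeries.C c'))).orderTop) :
    c = c' := by
  have h := congrArg (eval c) ((minpoly_map_constantCoeff hΨ hω c hc).symm.trans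
    (minpoly_map_constantCoeff hΨ' hω c' hc'))
  have hd := (minpoly.natDegree_pos hω).ne'
  simp only [eval_pow, eval_sub, eval_X, eval_C, sub_self, zero_pow hd] at h
  exact sub_eq_zero.mp (pow_eq_zero_iff hd |>.mp h.symm)

/-- An integral element with a nonzero constant value at one place is a unit. -/
theorem isIntegral_inv_of_orderTop_pos {l : Fin n}
    {Ψ : SeriesClosure K n →+* HahnSeries ℚ (SeriesClosure K n)} (hΨ : IsPlace l Ψ)
    {ω : SeriesClosure K n} (hω : IsIntegral (MvPowerSeries (Fin n) K) ω) {c : K} (hc0 : c ≠ 0)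
    (hc : 0 < (Ψ (ω - algebraMap (MvPowerSeries (Fin n) K) _ (MvPowerSeries.C c))).orderTop) :
    ω ≠ 0 ∧ IsIntegral (MvPowerSeries (Fin n) K) ω⁻¹ := by
  set μ := minpoly (MvPowerSeries (Fin n) K) ω with hμ
  have hu : IsUnit (μ.coeff 0) := by
    rw [MvPowerSeries.isUnit_iff_constantCoeff, isUnit_iff_ne_zero, ← coeff_map,
      minpoly_map_constantCoeff hΨ hω c hc, coeff_zero_eq_eval_zero]
    simpa using pow_ne_zero _ hc0
  obtain ⟨v, hv⟩ := hu.exists_right_inv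
  have h1 : aeval ω μ = 0 := minpoly.aeval _ _
  have h2 : ω * (-algebraMap _ _ v * aeval ω μ.divX) = 1 := by
    rw [← divX_mul_X_add μ, map_add, map_mul, aeval_X, aeval_C] at h1
    have h3 := congrArg (algebraMap _ (SeriesClosure K n)) hv
    rw [map_mul, map_one] at h3
    linear_combination h3 - algebraMap _ (SeriesClosure K n) v * h1
  refine ⟨left_ne_zero_of_mul_eq_one h2, ?_⟩
  rw [inv_eq_of_mul_eq_one_right h2]
  refine (isIntegral_algebraMap.neg).mul ?_
  exact isIntegral_aeval hω _

/-! ### Differences of roots and their logarithmic derivatives -/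

/-- There is a valuation of `SeriesClosure K n` that is centred at the maximal ideal of `K[[X]]`. -/
theorem exists_valuationSubring_dominating :
    ∃ V : ValuationSubring (SeriesClosure K n),
      (∀ ω, IsIntegral (MvPowerSeries (Fin n) K) ω → V.valuation ω ≤ 1) ∧
      ∀ f : MvPowerSeries (Fin n) K, MvPowerSeries.constantCoeff f = 0 →
        V.valuation (algebraMap _ _ f) < 1 := by
  set φ := algebraMap (MvPowerSeries (Fin n) K) (SeriesClosure K n) with hφ
  have hinj : Function.Injective φ := algebraMap_seriesClosure_injective
  let e : MvPowerSeries (Fin n) K ≃+* φ.range := RingEquiv.ofBijective φ.rangeRestrict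
    ⟨fun a b h => hinj (congrArg Subtype.val h), φ.rangeRestrict_surjective⟩
  let I : Ideal φ.range := (IsLocalRing.maximalIdeal (MvPowerSeries (Fin n) K)).comap e.symm
  have hI : I ≠ ⊤ := Ideal.IsPrime.ne_top (Ideal.comap_isPrime _ _)
  obtain ⟨V, hV, hV'⟩ := Ideal.image_subset_nonunits_valuationSubring I hI
  refine ⟨V, fun ω hω => ?_, fun f hf => ?_⟩
  · refine Valuation.Integers.mem_of_integral (Valuation.integer.integers V.valuation) ?_
    obtain ⟨p, hp, hpω⟩ := hω
    have hle : ∀ f, φ f ∈ V.valuation.integer := fun f =>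
      (V.valuation_le_one_iff _).mpr (hV ⟨f, rfl⟩)
    refine ⟨p.map (φ.codRestrict V.valuation.integer hle), hp.map _, ?_⟩
    rw [eval₂_map]
    exact hpω
  · rw [← ValuationSubring.mem_nonunits_iff]
    refine hV' ⟨e f, ?_, rfl⟩
    change e.symm (e f) ∈ IsLocalRing.maximalIdeal (MvPowerSeries (Fin n) K)
    rw [e.symm_apply_apply, mem_maximalIdeal_iff]
    exact hf

/-- The discriminant is a combination of `P` and its derivative, so `P'(z)` divides it for each
root `z`. -/
theorem exists_isIntegral_derivative_mul {P : (MvPowerSeries (Fin n) K)[X]} (hP : P.Monic)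
    (hd : P.natDegree ≠ 0) {f U : MvPowerSeries (Fin n) K}
    (hU : MvPowerSeries.constantCoeff U ≠ 0) (hdisc : P.discr = f * U) {z : SeriesClosure K n}
    (hz : aeval z P = 0) : ∃ w, IsIntegral (MvPowerSeries (Fin n) K) w ∧
      aeval z P.derivative * w = algebraMap _ _ f := by
  obtain ⟨A, B, -, -, hAB⟩ := exists_mul_add_mul_eq_C_resultant P P.derivative
    (m := P.natDegree) (n := P.natDegree - 1) le_rfl (natDegree_derivative_le _) (by omega)
  have hu : IsUnit (((-1) ^ (P.natDegree * (P.natDegree - 1) / 2) : MvPowerSeries (Fin n) K) * U) :=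
    (isUnit_one.neg.pow _).mul (by
      rw [MvPowerSeries.isUnit_iff_constantCoeff, isUnit_iff_ne_zero]; exact hU)
  obtain ⟨v, hv⟩ := hu.exists_right_inv
  rw [resultant_deriv (natDegree_pos_iff_degree_pos.mp (Nat.pos_of_ne_zero hd)), hP.leadingCoeff,
    mul_one, hdisc] at hAB
  have hint : IsIntegral (MvPowerSeries (Fin n) K) z := ⟨P, hP, hz⟩
  refine ⟨aeval z B * algebraMap _ _ v, ?_, ?_⟩
  · refine IsIntegral.mul ?_ isIntegral_algebraMap
    exact isIntegral_aeval hint _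
  · have h1 := congrArg (aeval z) hAB
    rw [map_add, map_mul, map_mul, hz, zero_mul, zero_add, aeval_C] at h1
    rw [← mul_assoc, h1, ← map_mul]
    congr 1
    linear_combination f * hv

/-- A difference of two roots divides `P'(z)`, which is the product of the differences. -/
theorem exists_isIntegral_sub_mul {P : (MvPowerSeries (Fin n) K)[X]} (hP : P.Monic)
    {z z' t : SeriesClosure K n} (hz : aeval z P = 0) (hz' : aeval z' P = 0) (hne : z ≠ z')
    (ht : ∃ w, IsIntegral (MvPowerSeries (Fin n) K) w ∧ aeval z P.derivative * w = t) :
    ∃ w, IsIntegral (MvPowerSeries (Fin n) K) w ∧ (z - z') * w = t := by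
  classical
  obtain ⟨w, hw, rfl⟩ := ht
  set p := P.map (algebraMap (MvPowerSeries (Fin n) K) (SeriesClosure K n)) with hp
  have hpm : p.Monic := hP.map _
  have hroot : ∀ x, x ∈ p.roots ↔ aeval x P = 0 := fun x => by
    rw [mem_roots hpm.ne_zero, IsRoot.def, hp, eval_map_algebraMap]
  have h1 := (IsAlgClosed.splits p).eval_root_derivative hpm ((hroot z).mpr hz)
  have h2 : z' ∈ p.roots.erase z := (Multiset.mem_erase_of_ne hne.symm).mpr ((hroot z').mpr hz')
  rw [← Multiset.cons_erase h2, Multiset.map_cons, Multiset.prod_cons, hp, derivative_map,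
    eval_map_algebraMap, ← hp] at h1
  refine ⟨_, IsIntegral.mul (IsIntegral.multiset_prod ?_) hw, by rw [h1, mul_assoc]⟩
  intro y hy
  obtain ⟨x, hx, rfl⟩ := Multiset.mem_map.mp hy
  have hx' := (hroot x).mp (Multiset.mem_of_mem_erase (Multiset.mem_of_mem_erase hx))
  exact IsIntegral.sub ⟨P, hP, hz⟩ ⟨P, hP, hx'⟩

/-- The value at the root `z` of `P` of the extension of `X_i ∂/∂X_i`, by implicit
differentiation. -/
def rootDerivative (P : (MvPowerSeries (Fin n) K)[X]) (i : Fin n) (z : SeriesClosure K n) :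
    SeriesClosure K n :=
  -aeval z (coeffwise (eulerDerivation (K := K) i).toLinearMap.toAddMonoidHom P) /
    aeval z P.derivative

theorem apply_rootDerivative {P : (MvPowerSeries (Fin n) K)[X]} {z : SeriesClosure K n}
    (hz : aeval z P = 0) (hz' : aeval z P.derivative ≠ 0) {l i : Fin n}
    {Ψ : SeriesClosure K n →+* HahnSeries ℚ (SeriesClosure K n)} (hΨ : IsPlace l Ψ)
    {D : HahnSeries ℚ (SeriesClosure K n) →+ HahnSeries ℚ (SeriesClosure K n)}
    (hD : ∀ a b, D (a * b) = a * D b + b * D a)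
    (hDi : ∀ f, D (toHahn l f) = toHahn l (eulerDerivation i f)) :
    Ψ (rootDerivative P i z) = D (Ψ z) := by
  have h1 := map_eval₂_of_leibniz (toHahn l)
    (eulerDerivation (K := K) i).toLinearMap.toAddMonoidHom D hD hDi P (Ψ z)
  rw [← hΨ.apply_aeval, ← hΨ.apply_aeval, ← hΨ.apply_aeval, hz, map_zero, map_zero] at h1
  have h2 : Ψ (aeval z P.derivative) ≠ 0 := by
    rwa [Ne, map_eq_zero]
  rw [rootDerivative, map_div₀, map_neg, div_eq_iff h2]
  linear_combination h1

/-- The logarithmic derivative of the difference `z - z'` of two roots of `P` along `X_i ∂/∂X_i`. -/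
def logDerivative (P : (MvPowerSeries (Fin n) K)[X]) (i : Fin n) (z z' : SeriesClosure K n) :
    SeriesClosure K n :=
  (rootDerivative P i z - rootDerivative P i z') / (z - z')

section
variable [CharZero K]

/-- A chosen place at `l`. -/
def place (l : Fin n) : SeriesClosure K n →+* HahnSeries ℚ (SeriesClosure K n) :=
  (exists_isPlace l).choose

theorem isPlace_place (l : Fin n) : IsPlace (K := K) l (place l) := (exists_isPlace l).choose_spec

/-- A logarithmic derivative has no poles, since a derivation in the coefficients does not lower the
order. -/
theorem orderTop_apply_logDerivative_nonneg {P : (MvPowerSeries (Fin n) K)[X]}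
    {z z' : SeriesClosure K n} (hz : aeval z P = 0) (hz' : aeval z' P = 0)
    (hd : aeval z P.derivative ≠ 0) (hd' : aeval z' P.derivative ≠ 0) (hne : z ≠ z')
    {l : Fin n} (i : Fin n) {Ψ : SeriesClosure K n →+* HahnSeries ℚ (SeriesClosure K n)}
    (hΨ : IsPlace l Ψ) : 0 ≤ (Ψ (logDerivative P i z z')).orderTop := by
  obtain ⟨D, hD⟩ := exists_derivation_seriesClosure (eulerDerivation (K := K) i)
  have hD' : ∀ a b, D.toLinearMap.toAddMonoidHom (a * b) = a * D b + b * D a :=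
    fun a b => D.leibniz a b
  have h1 : Ψ (z - z') ≠ 0 := by
    rwa [Ne, map_eq_zero, sub_eq_zero]
  have h2 : Ψ (logDerivative P i z z') * Ψ (z - z') =
      gradedDerivation D.toLinearMap.toAddMonoidHom 0 (Ψ (z - z')) := by
    rw [logDerivative, ← map_mul, div_mul_cancel₀ _ (sub_ne_zero.mpr hne), map_sub, map_sub,
      map_sub,
      apply_rootDerivative hz hd hΨ (gradedDerivation_mul hD' 0)
        (gradedDerivation_toHahn l i hD),
      apply_rootDerivative hz' hd' hΨ (gradedDerivation_mul hD' 0)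
        (gradedDerivation_toHahn l i hD)]
  have h3 := orderTop_le_orderTop_gradedDerivation D.toLinearMap.toAddMonoidHom 0
    (Ψ (z - z'))
  rw [← h2, HahnSeries.orderTop_mul] at h3
  obtain ⟨e, he⟩ := WithTop.ne_top_iff_exists.mp (HahnSeries.orderTop_ne_top.mpr h1)
  rw [← he] at h3
  by_contra hlt
  rw [not_le] at hlt
  obtain ⟨o, ho⟩ := WithTop.ne_top_iff_exists.mp hlt.ne_top
  rw [← ho] at hlt h3
  have h4 : e ≤ o + e := by exact_mod_cast h3
  have h5 : o < 0 := by exact_mod_cast hlt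
  linarith

/-- The value at a place over `X_l = 0` of the logarithmic derivative along `X_l ∂/∂X_l` is the
order of `z - z'`. -/
theorem orderTop_apply_logDerivative_sub_pos {P : (MvPowerSeries (Fin n) K)[X]}
    {z z' : SeriesClosure K n} (hz : aeval z P = 0) (hz' : aeval z' P = 0)
    (hd : aeval z P.derivative ≠ 0) (hd' : aeval z' P.derivative ≠ 0) (hne : z ≠ z')
    {l : Fin n} {Ψ : SeriesClosure K n →+* HahnSeries ℚ (SeriesClosure K n)}
    (hΨ : IsPlace l Ψ) {e : ℚ} (he : (Ψ (z - z')).orderTop = e) :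
    0 < (Ψ (logDerivative P l z z' - algebraMap (MvPowerSeries (Fin n) K) _
      (MvPowerSeries.C (algebraMap ℚ K e)))).orderTop := by
  have h1 : Ψ (z - z') ≠ 0 := by
    rwa [Ne, map_eq_zero, sub_eq_zero]
  have hzero : ∀ a b, (0 : SeriesClosure K n →+ SeriesClosure K n) (a * b) =
      a * (0 : SeriesClosure K n →+ SeriesClosure K n) b +
        b * (0 : SeriesClosure K n →+ SeriesClosure K n) a := fun a b => by simp
  have hC : toHahn l (MvPowerSeries.C (algebraMap ℚ K e)) =
      HahnSeries.C (algebraMap ℚ (SeriesClosure K n) e) :=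
    DFunLike.congr_fun (Subsingleton.elim (((toHahn l).comp MvPowerSeries.C).comp (algebraMap ℚ K))
      (HahnSeries.C.comp (algebraMap ℚ (SeriesClosure K n)))) e
  set y := Ψ (z - z') with hy
  set D := gradedDerivation 0 (algebraMap ℚ (SeriesClosure K n) : ℚ →+ SeriesClosure K n) with hD
  have h2 : Ψ (logDerivative P l z z') * y = D y := by
    rw [hy, logDerivative, ← map_mul, div_mul_cancel₀ _ (sub_ne_zero.mpr hne), map_sub, map_sub,
      map_sub,
      apply_rootDerivative hz hd hΨ (gradedDerivation_mul hzero _)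
        (gradedDerivation_zero_toHahn l),
      apply_rootDerivative hz' hd' hΨ (gradedDerivation_mul hzero _)
        (gradedDerivation_zero_toHahn l)]
  rw [map_sub, hΨ.apply_algebraMap, hC]
  have h3 : (e : WithTop ℚ) < ((Ψ (logDerivative P l z z') -
      HahnSeries.C (algebraMap ℚ (SeriesClosure K n) e)) * y).orderTop := by
    rw [sub_mul, h2]
    by_contra hlt
    rw [not_lt] at hlt
    obtain ⟨o, ho⟩ := WithTop.ne_top_iff_exists.mp (ne_top_of_le_ne_top WithTop.coe_ne_top hlt)
    rw [← ho] at hlt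
    have hlt' : o ≤ e := by exact_mod_cast hlt
    refine HahnSeries.coeff_orderTop_ne ho.symm ?_
    rw [HahnSeries.coeff_sub, HahnSeries.C_mul_eq_smul, HahnSeries.coeff_smul, hD,
      coeff_gradedDerivation, AddMonoidHom.zero_apply, zero_add, smul_eq_mul, sub_eq_zero]
    rcases hlt'.lt_or_eq with h | rfl
    · rw [HahnSeries.coeff_eq_zero_of_lt_orderTop (by rw [he]; exact_mod_cast h), mul_zero,
        mul_zero]
    · rfl
  by_contra hlt
  rw [HahnSeries.orderTop_mul, he] at h3
  rw [not_lt] at hlt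
  exact absurd h3 (not_lt.mpr ((add_le_add_left hlt _).trans (by rw [zero_add])))
end

section RootDifferences

theorem algebraMap_monomial_ne_zero (α : Fin n →₀ ℕ) :
    algebraMap (MvPowerSeries (Fin n) K) (SeriesClosure K n) (MvPowerSeries.monomial α 1) ≠ 0 := by
  rw [Ne, map_eq_zero_iff _ algebraMap_seriesClosure_injective]
  intro h
  have := congrArg (MvPowerSeries.coeff α) h
  simp at this

variable {P : (MvPowerSeries (Fin n) K)[X]} {α : Fin n →₀ ℕ}

/-- `P'(z)` divides `X ^ α` for each root `z` of `P`. -/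
def DerivativeDvd (P : (MvPowerSeries (Fin n) K)[X]) (α : Fin n →₀ ℕ) : Prop :=
  ∀ z : SeriesClosure K n, aeval z P = 0 → ∃ w, IsIntegral (MvPowerSeries (Fin n) K) w ∧
    aeval z P.derivative * w =
      algebraMap (MvPowerSeries (Fin n) K) _ (MvPowerSeries.monomial α 1)

theorem DerivativeDvd.ne_zero (hα : DerivativeDvd P α) {z : SeriesClosure K n}
    (hz : aeval z P = 0) : aeval z P.derivative ≠ 0 := by
  obtain ⟨w, -, h⟩ := hα z hz
  intro h0
  rw [h0, zero_mul] at h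
  exact algebraMap_monomial_ne_zero α h.symm

variable [CharZero K]

theorem isIntegral_logDerivative (hP : P.Monic) (hα : DerivativeDvd P α)
    {z z' : SeriesClosure K n} (hz : aeval z P = 0) (hz' : aeval z' P = 0) (hne : z ≠ z')
    (i : Fin n) : IsIntegral (MvPowerSeries (Fin n) K) (logDerivative P i z z') := by
  refine isIntegral_of_orderTop_nonneg (β := α + α) ?_ fun l Ψ hΨ =>
    orderTop_apply_logDerivative_nonneg hz hz' (hα.ne_zero hz) (hα.ne_zero hz') hne i hΨ
  obtain ⟨w, hw, hw'⟩ := exists_isIntegral_sub_mul hP hz hz' hne (hα z hz)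
  have hroot : ∀ x, aeval x P = 0 → IsIntegral (MvPowerSeries (Fin n) K)
      (algebraMap (MvPowerSeries (Fin n) K) _ (MvPowerSeries.monomial α 1) *
        rootDerivative P i x) := by
    intro x hx
    obtain ⟨v, hv, hv'⟩ := hα x hx
    have h0 := hα.ne_zero hx
    rw [← hv', rootDerivative, mul_assoc, mul_comm v, ← mul_assoc, mul_div_cancel₀ _ h0]
    exact (isIntegral_aeval ⟨P, hP, hx⟩ _).neg.mul hv
  have h1 : algebraMap (MvPowerSeries (Fin n) K) _ (MvPowerSeries.monomial (α + α) 1) *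
      logDerivative P i z z' =
      (algebraMap (MvPowerSeries (Fin n) K) _ (MvPowerSeries.monomial α 1) *
        rootDerivative P i z - algebraMap (MvPowerSeries (Fin n) K) _
          (MvPowerSeries.monomial α 1) * rootDerivative P i z') * w := by
    have h2 : MvPowerSeries.monomial (α + α) (1 : K) =
        MvPowerSeries.monomial α 1 * MvPowerSeries.monomial α 1 := by
      rw [MvPowerSeries.monomial_mul_monomial, one_mul]
    have h3 : z - z' ≠ 0 := sub_ne_zero.mpr hne
    rw [h2, map_mul, ← mul_sub, logDerivative]
    nth_rw 1 [← hw']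
    field_simp
  rw [h1]
  exact ((hroot z hz).sub (hroot z' hz')).mul hw

/-- The order of `z - z'` is the same at all places over `X_l = 0`. -/
theorem orderTop_apply_sub_eq (hP : P.Monic) (hα : DerivativeDvd P α)
    {z z' : SeriesClosure K n} (hz : aeval z P = 0) (hz' : aeval z' P = 0) (hne : z ≠ z')
    {l : Fin n} {Ψ Ψ' : SeriesClosure K n →+* HahnSeries ℚ (SeriesClosure K n)}
    (hΨ : IsPlace l Ψ) (hΨ' : IsPlace l Ψ') :
    (Ψ (z - z')).orderTop = (Ψ' (z - z')).orderTop := by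
  have hne' : ∀ Φ : SeriesClosure K n →+* HahnSeries ℚ (SeriesClosure K n), Φ (z - z') ≠ 0 :=
    fun Φ => by rwa [Ne, map_eq_zero, sub_eq_zero]
  obtain ⟨e, he⟩ := WithTop.ne_top_iff_exists.mp (HahnSeries.orderTop_ne_top.mpr (hne' Ψ))
  obtain ⟨e', he'⟩ := WithTop.ne_top_iff_exists.mp (HahnSeries.orderTop_ne_top.mpr (hne' Ψ'))
  have h := eq_of_orderTop_pos hΨ hΨ' (isIntegral_logDerivative hP hα hz hz' hne l)
    (orderTop_apply_logDerivative_sub_pos hz hz' (hα.ne_zero hz) (hα.ne_zero hz') hne hΨ he.symm)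
    (orderTop_apply_logDerivative_sub_pos hz hz' (hα.ne_zero hz) (hα.ne_zero hz') hne hΨ' he'.symm)
  rw [← he, ← he', (algebraMap ℚ K).injective h]

theorem orderTop_place_sub_comm (l : Fin n) (z z' : SeriesClosure K n) :
    (place l (z - z')).orderTop = (place l (z' - z)).orderTop := by
  rw [← neg_sub, map_neg, HahnSeries.orderTop_neg]

/-- Let `ω₁`, `ω₂`, `ω₃` be the logarithmic derivatives of `x - y`, `y - z`, `z - x` along
`X_a ∂/∂X_a`. Since the differences and their derivatives both add up to zero,
`(ω₁ - ω₃) (x - y) = (ω₃ - ω₂) (y - z)`. If the orders of `x - y` and `z - x` over `X_a = 0` differ,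
then `ω₁ - ω₃` is a unit, so `y - z` divides `x - y`. -/
theorem orderTop_sub_le_of_ne (hP : P.Monic) (hα : DerivativeDvd P α)
    {x y z : SeriesClosure K n} (hx : aeval x P = 0) (hy : aeval y P = 0) (hz : aeval z P = 0)
    (hxy : x ≠ y) (hyz : y ≠ z) (hxz : x ≠ z) {a : Fin n}
    (ha : (place a (x - y)).orderTop ≠ (place a (x - z)).orderTop) (l : Fin n) :
    (place l (y - z)).orderTop ≤ (place l (x - y)).orderTop := by
  rw [orderTop_place_sub_comm a x z] at ha
  have hne : ∀ u v : SeriesClosure K n, u ≠ v → place a (u - v) ≠ 0 :=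
    fun u v huv => by rwa [Ne, map_eq_zero, sub_eq_zero]
  obtain ⟨e₁, he₁⟩ := WithTop.ne_top_iff_exists.mp (HahnSeries.orderTop_ne_top.mpr (hne x y hxy))
  obtain ⟨e₃, he₃⟩ :=
    WithTop.ne_top_iff_exists.mp (HahnSeries.orderTop_ne_top.mpr (hne z x hxz.symm))
  set ω₁ := logDerivative P a x y with hω₁
  set ω₂ := logDerivative P a y z with hω₂
  set ω₃ := logDerivative P a z x with hω₃
  have i₁ : IsIntegral (MvPowerSeries (Fin n) K) ω₁ := isIntegral_logDerivative hP hα hx hy hxy a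
  have i₂ : IsIntegral (MvPowerSeries (Fin n) K) ω₂ := isIntegral_logDerivative hP hα hy hz hyz a
  have i₃ : IsIntegral (MvPowerSeries (Fin n) K) ω₃ :=
    isIntegral_logDerivative hP hα hz hx hxz.symm a
  have p₁ := orderTop_apply_logDerivative_sub_pos hx hy (hα.ne_zero hx) (hα.ne_zero hy) hxy
    (isPlace_place a) he₁.symm
  have p₃ := orderTop_apply_logDerivative_sub_pos hz hx (hα.ne_zero hz) (hα.ne_zero hx) hxz.symm
    (isPlace_place a) he₃.symm
  have hc : algebraMap ℚ K e₁ - algebraMap ℚ K e₃ ≠ 0 := by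
    rw [← map_sub, Ne, map_eq_zero, sub_eq_zero]
    rintro rfl
    exact ha (he₁.symm.trans he₃)
  obtain ⟨h0, hinv⟩ := isIntegral_inv_of_orderTop_pos (isPlace_place a) (i₁.sub i₃) hc (by
    have h1 : ω₁ - ω₃ - algebraMap (MvPowerSeries (Fin n) K) _
        (MvPowerSeries.C (algebraMap ℚ K e₁ - algebraMap ℚ K e₃)) =
        (ω₁ - algebraMap (MvPowerSeries (Fin n) K) _ (MvPowerSeries.C (algebraMap ℚ K e₁))) -
        (ω₃ - algebraMap (MvPowerSeries (Fin n) K) _ (MvPowerSeries.C (algebraMap ℚ K e₃))) := by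
      rw [map_sub, map_sub]; ring
    rw [h1, map_sub]
    exact (lt_min p₁ p₃).trans_le HahnSeries.min_orderTop_le_orderTop_sub)
  have h1 : ω₁ * (x - y) + ω₂ * (y - z) + ω₃ * (z - x) = 0 := by
    rw [hω₁, hω₂, hω₃, logDerivative, logDerivative, logDerivative,
      div_mul_cancel₀ _ (sub_ne_zero.mpr hxy), div_mul_cancel₀ _ (sub_ne_zero.mpr hyz),
      div_mul_cancel₀ _ (sub_ne_zero.mpr hxz.symm)]
    ring
  have h2 : x - y = (ω₃ - ω₂) * (ω₁ - ω₃)⁻¹ * (y - z) := by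
    rw [mul_right_comm, eq_mul_inv_iff_mul_eq₀ h0]
    linear_combination h1
  rw [h2, map_mul, HahnSeries.orderTop_mul]
  exact le_add_of_nonneg_left ((isPlace_place l).orderTop_nonneg ((i₃.sub i₂).mul hinv))

/-- The exponents of the differences of the roots with a fixed root `x` form a chain. -/
theorem orderTop_sub_comparable (hP : P.Monic) (hα : DerivativeDvd P α)
    {x y z : SeriesClosure K n} (hx : aeval x P = 0) (hy : aeval y P = 0) (hz : aeval z P = 0)
    (hxy : x ≠ y) (hxz : x ≠ z) :
    (∀ l, (place l (x - y)).orderTop ≤ (place l (x - z)).orderTop) ∨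
      ∀ l, (place l (x - z)).orderTop ≤ (place l (x - y)).orderTop := by
  rcases eq_or_ne y z with rfl | hyz
  · exact Or.inl fun l => le_rfl
  by_cases h12 : ∃ a, (place a (y - x)).orderTop ≠ (place a (y - z)).orderTop
  · obtain ⟨a, ha⟩ := h12
    refine Or.inr fun l => ?_
    rw [orderTop_place_sub_comm l x y]
    exact orderTop_sub_le_of_ne hP hα hy hx hz hxy.symm hxz hyz ha l
  push Not at h12
  by_cases h13 : ∃ a, (place a (x - z)).orderTop ≠ (place a (x - y)).orderTop
  · obtain ⟨a, ha⟩ := h13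
    refine Or.inl fun l => ?_
    rw [orderTop_place_sub_comm l x y, h12 l, orderTop_place_sub_comm l y z]
    exact orderTop_sub_le_of_ne hP hα hx hz hy hxz hyz.symm hxy ha l
  · push Not at h13
    exact Or.inl fun l => (h13 l).ge

theorem exists_orderTop_sub_minimal (hP : P.Monic) (hα : DerivativeDvd P α)
    (hd : 2 ≤ P.natDegree) : ∃ x y : SeriesClosure K n, aeval x P = 0 ∧ aeval y P = 0 ∧ x ≠ y ∧
      ∀ z, aeval z P = 0 → ∀ l, (place l (x - y)).orderTop ≤ (place l (x - z)).orderTop := by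
  classical
  set p := P.map (algebraMap (MvPowerSeries (Fin n) K) (SeriesClosure K n)) with hp
  have hpm : p.Monic := hP.map _
  have hroot : ∀ x, x ∈ p.roots ↔ aeval x P = 0 := fun x => by
    rw [mem_roots hpm.ne_zero, IsRoot.def, hp, eval_map_algebraMap]
  have hcard : Multiset.card p.roots = P.natDegree := by
    rw [← (IsAlgClosed.splits p).natDegree_eq_card_roots, hP.natDegree_map]
  obtain ⟨x, hx⟩ := Multiset.card_pos_iff_exists_mem.mp (by rw [hcard]; omega)
  have hS : (p.roots.toFinset.erase x).Nonempty := by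
    obtain ⟨y, hy⟩ := Multiset.card_pos_iff_exists_mem.mp
      (by rw [Multiset.card_erase_of_mem hx, hcard, Nat.pred_eq_sub_one]; omega)
    refine ⟨y, Finset.mem_erase.mpr ⟨?_, Multiset.mem_toFinset.mpr (Multiset.mem_of_mem_erase hy)⟩⟩
    rintro rfl
    have h1 := (IsAlgClosed.splits p).eval_root_derivative hpm hx
    rw [← Multiset.cons_erase hy, Multiset.map_cons, Multiset.prod_cons, sub_self, zero_mul, hp,
      derivative_map, eval_map_algebraMap] at h1
    exact hα.ne_zero ((hroot y).mp hx) h1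
  obtain ⟨y, hy, hmin⟩ := Finset.exists_minimalFor
    (fun z l => (place l (x - z)).orderTop) _ hS
  rw [Finset.mem_erase, Multiset.mem_toFinset, hroot] at hy
  refine ⟨x, y, (hroot x).mp hx, hy.2, hy.1.symm, fun z hz l => ?_⟩
  rcases eq_or_ne x z with rfl | hxz
  · simp
  rcases orderTop_sub_comparable hP hα ((hroot x).mp hx) hy.2 hz hy.1.symm hxz with h | h
  · exact h l
  · exact hmin (Finset.mem_erase.mpr ⟨hxz.symm, Multiset.mem_toFinset.mpr ((hroot z).mpr hz)⟩) h l

end RootDifferences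

/-! ### The dominant coefficient -/

section DominantCoefficient

/-- A common denominator of `δ`. -/
theorem exists_nat_mul_eq (δ : Fin n → ℚ) (hδ : ∀ l, 0 ≤ δ l) :
    ∃ (q : ℕ) (g : Fin n →₀ ℕ), q ≠ 0 ∧ ∀ l, (g l : ℚ) = q * δ l := by
  have h : ∀ l, ∃ k : ℕ, (k : ℚ) = ((∏ i, (δ i).den : ℕ) : ℚ) * δ l := by
    intro l
    obtain ⟨k, hk⟩ := Finset.dvd_prod_of_mem (fun i => (δ i).den) (Finset.mem_univ l)
    refine ⟨k * (δ l).num.toNat, ?_⟩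
    have h1 : (((δ l).num.toNat : ℕ) : ℚ) = (δ l).num := by
      exact_mod_cast Int.toNat_of_nonneg (Rat.num_nonneg.mpr (hδ l))
    have h2 : ((δ l).den : ℚ) * δ l = (δ l).num := Rat.den_mul_eq_num _
    rw [hk, Nat.cast_mul, Nat.cast_mul, h1, ← h2]
    ring
  choose g hg using h
  exact ⟨_, Finsupp.equivFunOnFinite.symm g,
    Finset.prod_ne_zero_iff.mpr fun i _ => (δ i).den_ne_zero, fun l => hg l⟩

/-- A lower bound for the orders of the roots bounds the exponents of the coefficients. -/
theorem le_of_coeff_ne_zero {P : (MvPowerSeries (Fin n) K)[X]} (hP : P.Monic) {l : Fin n}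
    {Ψ : SeriesClosure K n →+* HahnSeries ℚ (SeriesClosure K n)} (hΨ : IsPlace l Ψ) {c : ℚ}
    (hc : ∀ z, aeval z P = 0 → (c : WithTop ℚ) ≤ (Ψ z).orderTop) {j : ℕ} {m : Fin n →₀ ℕ}
    (hm : MvPowerSeries.coeff m (P.coeff j) ≠ 0) : ((P.natDegree : ℚ) - j) * c ≤ m l := by
  set p := P.map (algebraMap (MvPowerSeries (Fin n) K) (SeriesClosure K n)) with hp
  have hpm : p.Monic := hP.map _
  have hs := IsAlgClosed.splits p
  have hmap : P.map (toHahn l) = p.map Ψ := by rw [hp, Polynomial.map_map, hΨ]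
  have h1 := le_orderTop_coeff_prod c (p.map Ψ).roots (fun y hy => by
    rw [hs.roots_map] at hy
    obtain ⟨z, hz, rfl⟩ := Multiset.mem_map.mp hy
    rw [mem_roots hpm.ne_zero, IsRoot.def, hp, eval_map_algebraMap] at hz
    exact hc z hz) j
  rw [← (hs.map Ψ).eq_prod_roots_of_monic (hpm.map _), ← (hs.map Ψ).natDegree_eq_card_roots,
    hpm.natDegree_map, hP.natDegree_map, ← hmap, coeff_map, le_orderTop_toHahn_iff] at h1
  exact h1 m hm

/-- If the coefficient of `T ^ (d - i)` has valuation less than `γ ^ (i / q)` for all `i`, then the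
roots have valuation less than `γ ^ (1 / q)`. -/
theorem valuation_root_lt {P : (MvPowerSeries (Fin n) K)[X]} (hP : P.Monic)
    {Γ : Type*} [LinearOrderedCommGroupWithZero Γ] (v : Valuation (SeriesClosure K n) Γ)
    {q : ℕ} (hq : q ≠ 0) {γ : Γ} (hγ : γ ≠ 0)
    (hlt : ∀ j < P.natDegree, v (algebraMap _ _ (P.coeff j)) ^ q < γ ^ (P.natDegree - j))
    {z : SeriesClosure K n} (hz : aeval z P = 0) : v z ^ q < γ := by
  by_contra hle
  rw [not_lt] at hle
  have hγ0 : 0 < γ := zero_lt_iff.mpr hγ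
  have hv0 : 0 < v z := by
    rw [zero_lt_iff]
    intro h
    rw [h, zero_pow hq] at hle
    exact absurd hγ0 (not_lt.mpr hle)
  rw [aeval_eq_sum_range, Finset.sum_range_succ, hP.coeff_natDegree, one_smul,
    add_eq_zero_iff_eq_neg'] at hz
  have h1 : v (∑ j ∈ Finset.range P.natDegree, P.coeff j • z ^ j) < v z ^ P.natDegree := by
    refine v.map_sum_lt (pow_pos hv0 _).ne' fun j hj => ?_
    rw [Finset.mem_range] at hj
    rw [Algebra.smul_def, map_mul, map_pow]
    refine lt_of_pow_lt_pow_left₀ q zero_le ?_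
    calc (v (algebraMap _ _ (P.coeff j)) * v z ^ j) ^ q
        = v (algebraMap _ _ (P.coeff j)) ^ q * v z ^ (j * q) := by rw [mul_pow, ← pow_mul]
      _ < γ ^ (P.natDegree - j) * v z ^ (j * q) :=
          mul_lt_mul_of_pos_right (hlt j hj) (pow_pos hv0 _)
      _ ≤ (v z ^ q) ^ (P.natDegree - j) * v z ^ (j * q) := by gcongr
      _ = (v z ^ P.natDegree) ^ q := by
          obtain ⟨i, hi⟩ := Nat.exists_eq_add_of_le hj.le
          rw [hi, Nat.add_sub_cancel_left, ← pow_mul, ← pow_add, ← pow_mul]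
          congr 1
          ring
  rw [← map_pow, hz, Valuation.map_neg] at h1
  exact lt_irrefl _ h1

variable [CharZero K]

/-- If the sum of the roots is zero, then `deg P • x` is the sum of the differences `x - z`, so the
roots have at least the order of these differences. -/
theorem le_orderTop_root {P : (MvPowerSeries (Fin n) K)[X]} (hP : P.Monic)
    (hd : P.natDegree ≠ 0) (hnext : P.nextCoeff = 0) {x : SeriesClosure K n}
    {l : Fin n} {Ψ : SeriesClosure K n →+* HahnSeries ℚ (SeriesClosure K n)} (hΨ : IsPlace l Ψ)
    {c : WithTop ℚ} (hc : ∀ z, aeval z P = 0 → c ≤ (Ψ (x - z)).orderTop)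
    {z : SeriesClosure K n} (hz : aeval z P = 0) : c ≤ (Ψ z).orderTop := by
  set p := P.map (algebraMap (MvPowerSeries (Fin n) K) (SeriesClosure K n)) with hp
  have hpm : p.Monic := hP.map _
  have hroot : ∀ x, x ∈ p.roots ↔ aeval x P = 0 := fun x => by
    rw [mem_roots hpm.ne_zero, IsRoot.def, hp, eval_map_algebraMap]
  have hcard : Multiset.card p.roots = P.natDegree := by
    rw [← (IsAlgClosed.splits p).natDegree_eq_card_roots, hP.natDegree_map]
  have hsum : p.roots.sum = 0 := by
    have h1 := (IsAlgClosed.splits p).nextCoeff_eq_neg_sum_roots_of_monic hpm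
    rw [hp, nextCoeff_map algebraMap_seriesClosure_injective, hnext, map_zero, eq_comm,
      neg_eq_zero] at h1
    exact h1
  have h1 : (P.natDegree : SeriesClosure K n) * x = (p.roots.map fun z => x - z).sum := by
    rw [Multiset.sum_map_sub, Multiset.map_const', Multiset.sum_replicate, Multiset.map_id', hsum,
      hcard, sub_zero, nsmul_eq_mul]
  have hdK : (P.natDegree : K) ≠ 0 := Nat.cast_ne_zero.mpr hd
  have h2 : x = algebraMap (MvPowerSeries (Fin n) K) _ (MvPowerSeries.C ((P.natDegree : K)⁻¹)) *
      (p.roots.map fun z => x - z).sum := by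
    rw [← h1, ← mul_assoc]
    have h3 : (P.natDegree : SeriesClosure K n) = algebraMap (MvPowerSeries (Fin n) K) _
        (MvPowerSeries.C (P.natDegree : K)) := by rw [map_natCast, map_natCast]
    rw [h3, ← map_mul, ← map_mul, inv_mul_cancel₀ hdK, map_one, map_one, one_mul]
  have hx : c ≤ (Ψ x).orderTop := by
    rw [h2, map_mul, HahnSeries.orderTop_mul, map_multiset_sum, Multiset.map_map]
    refine le_add_of_nonneg_of_le (hΨ.orderTop_nonneg isIntegral_algebraMap)
      (le_orderTop_multiset_sum _ fun y hy => ?_)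
    obtain ⟨z, hz, rfl⟩ := Multiset.mem_map.mp hy
    exact hc z ((hroot z).mp hz)
  have h4 : z = x - (x - z) := by ring
  rw [h4, map_sub]
  exact (le_min hx (hc z hz)).trans HahnSeries.min_orderTop_le_orderTop_sub

/-- One of the coefficients of `P` is a monomial times a unit, and its exponent, divided by `d - j`,
is a lower bound for the exponents in the other coefficients. Indeed this quotient is the smallest
exponent `δ` of a difference `x - y` of roots. If no coefficient had a term on the bound given by
`δ`, then all roots, hence also `x - y`, would be smaller than `X ^ δ` for a valuation centred at
the maximal ideal, while `X ^ δ` is divisible by `x - y`. -/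
theorem exists_coef_eq_monomial_mul {P : (MvPowerSeries (Fin n) K)[X]} (hP : P.Monic)
    (hd : 2 ≤ P.natDegree) (hnext : P.nextCoeff = 0) {α : Fin n →₀ ℕ}
    {U : MvPowerSeries (Fin n) K} (hU : MvPowerSeries.constantCoeff U ≠ 0)
    (hdisc : P.discr = MvPowerSeries.monomial α 1 * U) :
    ∃ j < P.natDegree, ∃ (β : Fin n →₀ ℕ) (V : MvPowerSeries (Fin n) K),
      MvPowerSeries.constantCoeff V ≠ 0 ∧ P.coeff j = MvPowerSeries.monomial β 1 * V ∧
      ∀ k < P.natDegree, ∀ m, MvPowerSeries.coeff m (P.coeff k) ≠ 0 →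
        ∀ l, (P.natDegree - k) * β l ≤ (P.natDegree - j) * m l := by
  set d := P.natDegree with hdd
  have hα : DerivativeDvd P α := fun z hz =>
    exists_isIntegral_derivative_mul hP (by omega) hU hdisc hz
  obtain ⟨x, y, hx, hy, hxy, hmin⟩ := exists_orderTop_sub_minimal hP hα hd
  have hne : ∀ Φ : SeriesClosure K n →+* HahnSeries ℚ (SeriesClosure K n), Φ (x - y) ≠ 0 :=
    fun Φ => by rwa [Ne, map_eq_zero, sub_eq_zero]
  have hint : ∀ z : SeriesClosure K n, aeval z P = 0 → IsIntegral (MvPowerSeries (Fin n) K) z :=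
    fun z hz => ⟨P, hP, hz⟩
  choose δ hδ using fun l => WithTop.ne_top_iff_exists.mp
    (HahnSeries.orderTop_ne_top.mpr (hne (place l)))
  have hδ0 : ∀ l, 0 ≤ δ l := fun l => by
    have := (isPlace_place l).orderTop_nonneg ((hint x hx).sub (hint y hy))
    rw [← hδ] at this
    exact_mod_cast this
  obtain ⟨q, g, hq, hg⟩ := exists_nat_mul_eq δ hδ0
  have hsupp : ∀ j m, MvPowerSeries.coeff m (P.coeff j) ≠ 0 → ∀ l, ((d : ℚ) - j) * δ l ≤ m l :=
    fun j m hm l => le_of_coeff_ne_zero hP (isPlace_place l) (fun z hz =>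
      le_orderTop_root hP (by omega) hnext (isPlace_place l) (x := x)
        (fun z hz => (hδ l).trans_le (hmin z hz l)) hz) hm
  have hqQ : (0 : ℚ) < q := by exact_mod_cast Nat.pos_of_ne_zero hq
  -- `a_i ^ q` is divisible by `X ^ (i g)`
  have hdvd : ∀ j < d, MvPowerSeries.monomial ((d - j) • g) (1 : K) ∣ P.coeff j ^ q := by
    intro j hj
    rw [monomial_dvd_iff]
    intro m hm l
    have h3 := le_of_coeff_pow_ne_zero (fun m hm => hsupp j m hm l) q hm
    rw [mul_left_comm, ← hg, ← Nat.cast_sub hj.le] at h3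
    exact_mod_cast h3
  choose! c hc using hdvd
  have hunit : ∃ j < d, MvPowerSeries.constantCoeff (c j) ≠ 0 := by
    by_contra! hall
    obtain ⟨V, hVi, hVm⟩ := exists_valuationSubring_dominating (K := K) (n := n)
    set t := algebraMap (MvPowerSeries (Fin n) K) (SeriesClosure K n) (MvPowerSeries.monomial g 1)
      with ht
    have ht0 : t ≠ 0 := algebraMap_monomial_ne_zero g
    have hγ : V.valuation t ≠ 0 := by rwa [Ne, map_eq_zero]
    have hlt : ∀ j < P.natDegree, V.valuation (algebraMap _ _ (P.coeff j)) ^ q <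
        V.valuation t ^ (P.natDegree - j) := by
      intro j hj
      have h2 : MvPowerSeries.monomial ((d - j) • g) (1 : K) =
          MvPowerSeries.monomial g 1 ^ (d - j) := by
        rw [MvPowerSeries.monomial_pow, one_pow]
      rw [← map_pow, ← map_pow, hc j hj, map_mul, map_mul, h2, map_pow, map_pow, ← hdd, ← ht]
      exact mul_lt_of_lt_one_right (pow_pos (zero_lt_iff.mpr hγ) _) (hVm _ (hall j hj))
    have hxlt := valuation_root_lt hP V.valuation hq hγ hlt hx
    have hylt := valuation_root_lt hP V.valuation hq hγ hlt hy
    have hu : IsIntegral (MvPowerSeries (Fin n) K) (t / (x - y) ^ q) := by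
      have hxy0 : x - y ≠ 0 := sub_ne_zero.mpr hxy
      refine isIntegral_of_orderTop_nonneg (β := q • α) ?_ fun l Ψ hΨ => ?_
      · obtain ⟨w, hw, hw'⟩ := exists_isIntegral_sub_mul hP hx hy hxy (hα x hx)
        have h2 : MvPowerSeries.monomial (q • α) (1 : K) = MvPowerSeries.monomial α 1 ^ q := by
          rw [MvPowerSeries.monomial_pow, one_pow]
        rw [h2, map_pow, ← hw', mul_pow, mul_div_assoc', mul_assoc, mul_comm, mul_div_assoc,
          div_self (pow_ne_zero _ hxy0), mul_one]
        exact (hw.pow q).mul isIntegral_algebraMap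
      · have h1 := orderTop_apply_sub_eq hP hα hx hy hxy hΨ (isPlace_place l)
        rw [← hδ] at h1
        have h2 : Ψ (t / (x - y) ^ q) * Ψ (x - y) ^ q = Ψ t := by
          rw [← map_pow, ← map_mul, div_mul_cancel₀ _ (pow_ne_zero _ hxy0)]
        have h3 : ∀ k : ℕ, (Ψ (x - y) ^ k).orderTop = ((k * δ l : ℚ) : WithTop ℚ) := by
          intro k
          induction k with
          | zero => simp
          | succ k ih =>
            rw [pow_succ, HahnSeries.orderTop_mul, ih, h1, ← WithTop.coe_add]
            congr 1
            push_cast; ring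
        have h4 : ((q * δ l : ℚ) : WithTop ℚ) ≤ (Ψ t).orderTop := by
          rw [ht, hΨ.apply_algebraMap, le_orderTop_toHahn_iff]
          intro m hm
          classical
          rw [MvPowerSeries.coeff_monomial] at hm
          rw [(ite_ne_right_iff.mp hm).1, hg]
        rw [← h2, HahnSeries.orderTop_mul, h3] at h4
        by_contra hlt
        rw [not_le] at hlt
        obtain ⟨o, ho⟩ := WithTop.ne_top_iff_exists.mp hlt.ne_top
        rw [← ho] at hlt h4
        have h5 : q * δ l ≤ o + q * δ l := by exact_mod_cast h4
        have h6 : o < 0 := by exact_mod_cast hlt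
        linarith
    have h1 := hVi _ hu
    rw [map_div₀, map_pow] at h1
    have h2 : V.valuation (x - y) ^ q < V.valuation t := by
      rcases le_total (V.valuation x) (V.valuation y) with h | h
      · exact (pow_le_pow_left₀ zero_le
          ((V.valuation.map_sub x y).trans (max_le h le_rfl)) q).trans_lt
          hylt
      · exact (pow_le_pow_left₀ zero_le
          ((V.valuation.map_sub x y).trans (max_le le_rfl h)) q).trans_lt
          hxlt
    have h0 : 0 < V.valuation (x - y) ^ q := by
      refine pow_pos (zero_lt_iff.mpr ?_) _
      rw [Ne, map_eq_zero]
      exact sub_ne_zero.mpr hxy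
    rw [div_le_one₀ h0] at h1
    exact absurd h2 (not_lt.mpr h1)
  obtain ⟨j, hj, hcj⟩ := hunit
  have hdj : (0 : ℚ) < (d : ℚ) - j := sub_pos.mpr (by exact_mod_cast hj)
  -- `β = ⌈i δ⌉`
  let β : Fin n →₀ ℕ := Finsupp.equivFunOnFinite.symm fun l => ⌈((d : ℚ) - j) * δ l⌉₊
  have hβ : ∀ l, ((d : ℚ) - j) * δ l ≤ β l := fun l => Nat.le_ceil _
  obtain ⟨b, hb⟩ : MvPowerSeries.monomial β (1 : K) ∣ P.coeff j := by
    rw [monomial_dvd_iff]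
    exact fun m hm l => Nat.ceil_le.mpr (hsupp j m hm l)
  have hgβ : (d - j) • g ≤ q • β := by
    intro l
    have h1 : ((d : ℚ) - j) * (q * δ l) ≤ q * β l := by
      have := mul_le_mul_of_nonneg_left (hβ l) hqQ.le
      linarith
    rw [← hg, ← Nat.cast_sub hj.le] at h1
    simpa using (by exact_mod_cast h1 : (d - j) * g l ≤ q * β l)
  obtain ⟨ε, hε⟩ := exists_add_of_le hgβ
  have hcb : c j = MvPowerSeries.monomial ε 1 * b ^ q := by
    have h1 : MvPowerSeries.monomial ((d - j) • g) (1 : K) ≠ 0 := fun h => by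
      have := congrArg (MvPowerSeries.coeff ((d - j) • g)) h
      simp at this
    refine mul_left_cancel₀ h1 ?_
    rw [← hc j hj, hb, mul_pow, MvPowerSeries.monomial_pow, one_pow, hε, ← mul_assoc,
      MvPowerSeries.monomial_mul_monomial, one_mul]
  rw [hcb, map_mul, map_pow] at hcj
  have hb0 : MvPowerSeries.constantCoeff b ≠ 0 := fun h =>
    hcj (by rw [h, zero_pow hq, mul_zero])
  have hε0 : ε = 0 := by
    by_contra h
    refine hcj ?_
    classical
    rw [← MvPowerSeries.coeff_zero_eq_constantCoeff_apply, MvPowerSeries.coeff_monomial,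
      if_neg (Ne.symm h), zero_mul]
  refine ⟨j, hj, β, b, hb0, hb, fun k hk m hm l => ?_⟩
  have h1 : (q * β l : ℚ) = ((d : ℚ) - j) * (q * δ l) := by
    have h2 := DFunLike.congr_fun hε l
    rw [hε0, add_zero] at h2
    rw [← hg, ← Nat.cast_sub hj.le]
    exact_mod_cast (by simpa using h2 : q * β l = (d - j) * g l)
  have h2 : (β l : ℚ) = ((d : ℚ) - j) * δ l := by
    apply mul_left_cancel₀ hqQ.ne'
    linarith
  have h3 := mul_le_mul_of_nonneg_left (hsupp k m hm l) hdj.le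
  have h4 : ((d : ℚ) - k) * β l ≤ ((d : ℚ) - j) * m l := by
    rw [h2]; linarith
  rw [← Nat.cast_sub hj.le, ← Nat.cast_sub hk.le] at h4
  exact_mod_cast h4

end DominantCoefficient

/-! ### Convex geometry -/

/-- The points `((t / i₀) β, d - t)`, which for `0 ≤ t ≤ d` form the segment from `(0, d)` through
`(β, d - i₀)` to `((d / i₀) β, 0)`. -/
def edgePoint (d i₀ : ℕ) (β : Fin n →₀ ℕ) (t : ℝ) : (Fin n → ℝ) × ℝ :=
  (fun l => t * (β l / i₀), d - t)

theorem segment_edgePoint (d i₀ : ℕ) (β : Fin n →₀ ℕ) (hd : d ≠ 0) :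
    segment ℝ (edgePoint d i₀ β 0) (edgePoint d i₀ β d) =
      edgePoint d i₀ β '' Set.Icc 0 (d : ℝ) := by
  have hd' : (0 : ℝ) < d := by exact_mod_cast Nat.pos_of_ne_zero hd
  have h : ∀ θ : ℝ, (1 - θ) • edgePoint d i₀ β 0 + θ • edgePoint d i₀ β d =
      edgePoint d i₀ β (θ * d) := by
    intro θ
    ext l
    · simp [edgePoint]; ring
    · simp [edgePoint]; ring
  rw [segment_eq_image]
  ext x
  constructor
  · rintro ⟨θ, hθ, rfl⟩
    exact ⟨θ * d, ⟨mul_nonneg hθ.1 hd'.le, mul_le_of_le_one_left hd'.le hθ.2⟩, (h θ).symm⟩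
  · rintro ⟨t, ht, rfl⟩
    refine ⟨t / d, ⟨div_nonneg ht.1 hd'.le, (div_le_one hd').mpr ht.2⟩, ?_⟩
    simp only [h]
    rw [div_mul_cancel₀ _ hd'.ne']

theorem convex_iUnion_Ici {E : Type*} [AddCommGroup E] [PartialOrder E] [IsOrderedAddMonoid E]
    [Module ℝ E] [PosSMulMono ℝ E] {S : Set E} (hS : Convex ℝ S) :
    Convex ℝ (⋃ s ∈ S, Set.Ici s) := by
  intro x hx y hy a b ha hb hab
  simp only [Set.mem_iUnion, Set.mem_Ici, exists_prop] at hx hy ⊢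
  obtain ⟨s, hs, hsx⟩ := hx
  obtain ⟨t, ht, hty⟩ := hy
  exact ⟨a • s + b • t, hS hs ht ha hb hab,
    add_le_add (smul_le_smul_of_nonneg_left hsx ha) (smul_le_smul_of_nonneg_left hty hb)⟩

/-- If `f ≤ c` on `A`, then the face `f = c` of the hull of `A` is spanned by points of `A`. -/
theorem mem_convexHull_of_forall_le {E : Type*} [AddCommGroup E] [Module ℝ E] (f : E →ₗ[ℝ] ℝ)
    {A : Set E} {c : ℝ} (hA : ∀ a ∈ A, f a ≤ c) {x : E} (hx : x ∈ convexHull ℝ A)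
    (hfx : f x = c) : x ∈ convexHull ℝ {a ∈ A | f a = c} := by
  set B := convexHull ℝ {a ∈ A | f a = c} with hB
  have hBf : ∀ y ∈ B, f y = c := fun y hy =>
    (convexHull_min (fun a ha => ha.2) (convex_hyperplane f.isLinear c) : B ⊆ {y | f y = c}) hy
  have hconv : Convex ℝ (B ∪ {y | f y < c}) := by
    have hle : ∀ y ∈ B ∪ {y | f y < c}, f y ≤ c := by
      rintro y (hy | hy)
      · exact (hBf y hy).le
      · exact le_of_lt hy
    intro y hy z hz a b ha hb hab
    by_cases hy' : f y = c
    · by_cases hz' : f z = c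
      · refine Or.inl (convex_convexHull ℝ _ ?_ ?_ ha hb hab)
        · exact hy.resolve_right fun h => (ne_of_lt h) hy'
        · exact hz.resolve_right fun h => (ne_of_lt h) hz'
      · rcases hb.eq_or_lt with rfl | hb'
        · rw [add_zero] at hab
          simpa [hab] using hy
        · right
          have h1 := lt_of_le_of_ne (hle z hz) hz'
          have h2 := hle y hy
          simp only [Set.mem_ofPred_eq, map_add, map_smul, smul_eq_mul]
          have : c = a * c + b * c := by rw [← add_mul, hab, one_mul]
          nlinarith
    · rcases ha.eq_or_lt with rfl | ha'
      · rw [zero_add] at hab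
        simpa [hab] using hz
      · right
        have h1 := lt_of_le_of_ne (hle y hy) hy'
        have h2 := hle z hz
        simp only [Set.mem_ofPred_eq, map_add, map_smul, smul_eq_mul]
        have : c = a * c + b * c := by rw [← add_mul, hab, one_mul]
        nlinarith
  have hsub : A ⊆ B ∪ {y | f y < c} := by
    intro a ha
    rcases (hA a ha).lt_or_eq with h | h
    · exact Or.inr h
    · exact Or.inl (subset_convexHull ℝ _ ⟨ha, h⟩)
  exact (convexHull_min hsub hconv hx).resolve_right fun h => (ne_of_lt h) hfx

/-! ### The ideal of the coefficients -/

/-- `a_{i₀}` is `X ^ β` times the unit `V`, and the exponents `m` of each coefficient `a_i` satisfy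
`m / i ≥ β / i₀` componentwise. The inequality is multiplied out to stay in `ℕ`. -/
structure HasDominantCoef (P : (MvPowerSeries (Fin n) K)[X]) (i₀ : ℕ) (β : Fin n →₀ ℕ)
    (V : MvPowerSeries (Fin n) K) : Prop where
  two_le : 2 ≤ i₀
  le_natDegree : i₀ ≤ P.natDegree
  constantCoeff_ne_zero : MvPowerSeries.constantCoeff V ≠ 0
  coef_eq : coef P i₀ = MvPowerSeries.monomial β 1 * V
  le : ∀ i ∈ Finset.Icc 1 P.natDegree, ∀ m, MvPowerSeries.coeff m (coef P i) ≠ 0 →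
    ∀ l, i * β l ≤ i₀ * m l

theorem exists_hasDominantCoef [CharZero K] {P : (MvPowerSeries (Fin n) K)[X]} (hP : P.Monic)
    (hd : 2 ≤ P.natDegree) (hP1 : coef P 1 = 0) (hqo : IsQuasiOrdinary P) :
    ∃ i₀ β V, HasDominantCoef P i₀ β V := by
  obtain ⟨α, U, hU, hdisc⟩ := hqo
  have hnext : P.nextCoeff = 0 := by
    rw [nextCoeff_of_natDegree_pos (by omega)]
    exact hP1
  obtain ⟨j, hj, β, V, hV, hjV, hle⟩ := exists_coef_eq_monomial_mul hP hd hnext hU hdisc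
  have hcoef : coef P (P.natDegree - j) = P.coeff j := by
    rw [coef, Nat.sub_sub_self hj.le]
  refine ⟨P.natDegree - j, β, V, ?_, Nat.sub_le _ _, hV, hcoef.trans hjV, fun i hi m hm l => ?_⟩
  · by_contra hlt
    have h1 : P.natDegree - j = 1 := by omega
    rw [h1, hP1, hjV] at hcoef
    have h2 := congrArg (MvPowerSeries.coeff β) hcoef
    have h3 : MvPowerSeries.coeff (β + 0) (MvPowerSeries.monomial β 1 * V) =
        1 * MvPowerSeries.coeff 0 V :=
      MvPowerSeries.coeff_add_monomial_mul _ _ _ _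
    rw [add_zero, ← h2, map_zero, one_mul] at h3
    exact hV h3.symm
  · rw [Finset.mem_Icc] at hi
    have := hle (P.natDegree - i) (by omega) m hm l
    rwa [Nat.sub_sub_self hi.2] at this

section
variable {P : (MvPowerSeries (Fin n) K)[X]} {i₀ : ℕ} {β : Fin n →₀ ℕ} {V : MvPowerSeries (Fin n) K}

theorem HasDominantCoef.coefIdeal_eq (h : HasDominantCoef P i₀ β V) :
    coefIdeal P = Ideal.span {MvPowerSeries.monomial ((P.natDegree.factorial / i₀) • β) (1 : K)} ∧
      coefIdeal P = Ideal.span {coef P i₀ ^ (P.natDegree.factorial / i₀)} := by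
  set N := P.natDegree.factorial with hN
  have hi₀ := h.two_le
  have hi₀Q : (0 : ℚ) < i₀ := by exact_mod_cast (by omega : 0 < i₀)
  have hu : IsUnit (V ^ (N / i₀)) := IsUnit.pow _ (by
    rw [MvPowerSeries.isUnit_iff_constantCoeff, isUnit_iff_ne_zero]
    exact h.constantCoeff_ne_zero)
  have h1 : coef P i₀ ^ (N / i₀) =
      MvPowerSeries.monomial ((N / i₀) • β) (1 : K) * V ^ (N / i₀) := by
    rw [h.coef_eq, mul_pow, MvPowerSeries.monomial_pow, one_pow]
  have h2 : Ideal.span {coef P i₀ ^ (N / i₀)} =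
      Ideal.span {MvPowerSeries.monomial ((N / i₀) • β) (1 : K)} := by
    rw [h1]
    exact Ideal.span_singleton_mul_right_unit hu _
  have h3 : coefIdeal P = Ideal.span {coef P i₀ ^ (N / i₀)} := by
    apply le_antisymm
    · rw [coefIdeal, Ideal.span_le]
      rintro f ⟨i, hi, rfl⟩
      rw [Finset.mem_Icc] at hi
      rw [h2, SetLike.mem_coe, Ideal.mem_span_singleton, monomial_dvd_iff]
      intro m hm l
      have hiQ : (0 : ℚ) < i := by exact_mod_cast (by omega : 0 < i)
      have h4 := le_of_coeff_pow_ne_zero (l := l) (c := i * β l / i₀) (fun m hm => by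
        rw [div_le_iff₀ hi₀Q, mul_comm (m l : ℚ)]
        exact_mod_cast h.le i (Finset.mem_Icc.mpr ⟨by omega, hi.2⟩) m hm l) _ hm
      obtain ⟨k, hk⟩ := Nat.dvd_factorial (by omega : 0 < i) hi.2
      obtain ⟨k₀, hk₀⟩ := Nat.dvd_factorial (by omega : 0 < i₀) h.le_natDegree
      rw [hk, Nat.mul_div_cancel_left _ (by omega)] at h4
      have h5 : (i : ℚ) * k = i₀ * k₀ := by exact_mod_cast hk.symm.trans hk₀
      have h6 : ((k₀ * β l : ℕ) : ℚ) ≤ m l := by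
        refine le_of_eq_of_le ?_ h4
        push_cast
        field_simp
        linear_combination -(β l : ℚ) * h5
      rw [hN, hk₀, Nat.mul_div_cancel_left _ (by omega)]
      simpa using (by exact_mod_cast h6 : k₀ * β l ≤ m l)
    · rw [Ideal.span_singleton_le_iff_mem]
      exact Ideal.subset_span ⟨i₀, Finset.mem_Icc.mpr ⟨hi₀, h.le_natDegree⟩, rfl⟩
  exact ⟨h3.trans h2, h3⟩

end

/-! ### The Newton polyhedron -/

theorem coeff_linear_pow {A : Type*} [CommRing A] (a b : A) (k j : ℕ) :
    ((C a * X + C b) ^ k).coeff j = a ^ j * b ^ (k - j) * (k.choose j : A) := by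
  rw [add_pow, finsetSum_coeff]
  have h : ∀ i, ((C a * X) ^ i * C b ^ (k - i) * (k.choose i : A[X])).coeff j =
      if i = j then a ^ j * b ^ (k - j) * (k.choose j : A) else 0 := by
    intro i
    have h1 : (C a * X) ^ i * C b ^ (k - i) * (k.choose i : A[X]) =
        C (a ^ i * b ^ (k - i) * (k.choose i : A)) * X ^ i := by
      simp only [map_mul, map_pow, map_natCast]; ring
    rw [h1, coeff_C_mul_X_pow]
    by_cases hij : i = j
    · subst hij; simp
    · simp [hij, Ne.symm hij]
  rw [Finset.sum_congr rfl fun i _ => h i, Finset.sum_ite_eq']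
  split_ifs with hj
  · rfl
  · rw [Nat.choose_eq_zero_of_lt (by rw [Finset.mem_range] at hj; omega), Nat.cast_zero, mul_zero]

/-- A functional that is negative on the orthant is strictly decreasing. -/
theorem lt_of_neg_of_le {f : (Fin n → ℝ) × ℝ →ₗ[ℝ] ℝ} (h1 : ∀ l, f (Pi.single l 1, 0) < 0)
    (h2 : f (0, 1) < 0) {x y : (Fin n → ℝ) × ℝ} (hxy : x ≤ y) (hne : x ≠ y) : f y < f x := by
  classical
  have hdecomp : ∀ v : (Fin n → ℝ) × ℝ,
      f v = ∑ l, v.1 l * f (Pi.single l 1, 0) + v.2 * f (0, 1) := by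
    intro v
    have : v = ∑ l, v.1 l • ((Pi.single l 1, 0) : (Fin n → ℝ) × ℝ) + v.2 • (0, 1) := by
      ext k
      · simp [Prod.fst_sum, Finset.sum_apply, Pi.single_apply]
      · simp [Prod.snd_sum]
    conv_lhs => rw [this]
    simp only [map_add, map_sum, map_smul, smul_eq_mul]
  rw [← sub_neg, ← map_sub, hdecomp]
  have h3 : ∀ l, (y - x).1 l * f (Pi.single l 1, 0) ≤ 0 := fun l =>
    mul_nonpos_of_nonneg_of_nonpos (sub_nonneg.mpr (hxy.1 l)) (h1 l).le
  have h4 : (y - x).2 * f (0, 1) ≤ 0 :=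
    mul_nonpos_of_nonneg_of_nonpos (sub_nonneg.mpr hxy.2) h2.le
  by_contra hcon
  rw [not_lt] at hcon
  have h5 := Finset.sum_nonpos fun l (_ : l ∈ Finset.univ) => h3 l
  have h6 : ∑ l, (y - x).1 l * f (Pi.single l 1, 0) = 0 := by linarith
  have h7 : (y - x).2 * f (0, 1) = 0 := by linarith
  rw [Finset.sum_eq_zero_iff_of_nonpos fun l _ => h3 l] at h6
  refine hne (Prod.ext (funext fun l => ?_) ?_)
  · have := (mul_eq_zero.mp (h6 l (Finset.mem_univ l))).resolve_right (h1 l).ne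
    exact (sub_eq_zero.mp this).symm
  · exact (sub_eq_zero.mp ((mul_eq_zero.mp h7).resolve_right h2.ne)).symm

theorem newtonPolyhedron_mem_of_le {P : (MvPowerSeries (Fin n) K)[X]} {x y : (Fin n → ℝ) × ℝ}
    (hx : x ∈ newtonPolyhedron P) (hxy : x ≤ y) : y ∈ newtonPolyhedron P := by
  have hv : 0 ≤ y - x := sub_nonneg.mpr hxy
  have : newtonPolyhedron P ⊆ (fun z => (y - x) + z) ⁻¹' newtonPolyhedron P := by
    refine convexHull_min (fun z hz => subset_convexHull ℝ _ ?_)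
      ((convex_convexHull ℝ _).translate_preimage_right (y - x))
    simp only [Set.mem_iUnion, Set.mem_Ici, exists_prop] at hz ⊢
    obtain ⟨a, ha, haz⟩ := hz
    exact ⟨a, ha, haz.trans (le_add_of_nonneg_left hv)⟩
  simpa using this hx

theorem mem_newtonPolyhedron_of_coeff_ne_zero {P : (MvPowerSeries (Fin n) K)[X]} {m : Fin n →₀ ℕ}
    {k : ℕ} (h : MvPowerSeries.coeff m (P.coeff k) ≠ 0) :
    latticePoint m k ∈ newtonPolyhedron P :=
  subset_convexHull ℝ _ (Set.mem_biUnion ⟨m, k, h, rfl⟩ Set.self_mem_Ici)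

theorem topPoint_mem_newtonPolyhedron {P : (MvPowerSeries (Fin n) K)[X]} (hP : P.Monic) :
    topPoint P ∈ newtonPolyhedron P := by
  have := mem_newtonPolyhedron_of_coeff_ne_zero (P := P) (m := 0) (k := P.natDegree) (by
    rw [hP.coeff_natDegree]; simp)
  simpa [latticePoint, topPoint, Pi.zero_def] using this

theorem edgePoint_zero (P : (MvPowerSeries (Fin n) K)[X]) (i₀ : ℕ) (β : Fin n →₀ ℕ) :
    edgePoint P.natDegree i₀ β 0 = topPoint P := by
  simp [edgePoint, topPoint, Pi.zero_def]

theorem coeff_coeff_restrict {P : (MvPowerSeries (Fin n) K)[X]} (S : Set ((Fin n → ℝ) × ℝ))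
    (k : ℕ) (m : Fin n →₀ ℕ) :
    (latticePoint m k ∈ S → MvPowerSeries.coeff m ((restrict P S).coeff k) =
      MvPowerSeries.coeff m (P.coeff k)) ∧
    (latticePoint m k ∉ S → MvPowerSeries.coeff m ((restrict P S).coeff k) = 0) := by
  classical
  have h : ∀ f : MvPowerSeries (Fin n) K, MvPowerSeries.coeff m (restrictSeries f k S) =
      if latticePoint m k ∈ S then MvPowerSeries.coeff m f else 0 := fun f => rfl
  have h1 : (restrict P S).coeff k =
      if k ≤ P.natDegree then restrictSeries (P.coeff k) k S else 0 := by
    rw [restrict, finsetSum_coeff]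
    simp only [coeff_monomial, Finset.sum_ite_eq', Finset.mem_range, Nat.lt_succ_iff]
  rw [h1]
  by_cases hk : k ≤ P.natDegree
  · rw [if_pos hk, h]
    exact ⟨fun hS => if_pos hS, fun hS => if_neg hS⟩
  · rw [if_neg hk, coeff_eq_zero_of_natDegree_lt (not_le.mp hk)]
    exact ⟨fun _ => rfl, fun _ => map_zero _⟩

variable {P : (MvPowerSeries (Fin n) K)[X]} {i₀ : ℕ} {β : Fin n →₀ ℕ} {V : MvPowerSeries (Fin n) K}

/-- The segment from `topPoint P` through the exponent `(β, d - i₀)` to `ℝ ^ n × 0`. -/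
def edgeSegment (P : (MvPowerSeries (Fin n) K)[X]) (i₀ : ℕ) (β : Fin n →₀ ℕ) :
    Set ((Fin n → ℝ) × ℝ) :=
  segment ℝ (topPoint P) (edgePoint P.natDegree i₀ β P.natDegree)

namespace HasDominantCoef

theorem edgeSegment_eq (h : HasDominantCoef P i₀ β V) :
    edgeSegment P i₀ β = edgePoint P.natDegree i₀ β '' Set.Icc 0 (P.natDegree : ℝ) := by
  rw [edgeSegment, ← edgePoint_zero P i₀ β]
  have := h.two_le
  have := h.le_natDegree
  exact segment_edgePoint _ _ _ (by omega)

theorem coeff_ne_zero (h : HasDominantCoef P i₀ β V) :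
    MvPowerSeries.coeff β (P.coeff (P.natDegree - i₀)) ≠ 0 := by
  have h3 : MvPowerSeries.coeff (β + 0) (MvPowerSeries.monomial β 1 * V) =
      1 * MvPowerSeries.coeff 0 V := MvPowerSeries.coeff_add_monomial_mul _ _ _ _
  rw [add_zero, one_mul, ← h.coef_eq] at h3
  rw [coef] at h3
  rw [h3]
  exact h.constantCoeff_ne_zero

theorem edgePoint_eq_latticePoint (h : HasDominantCoef P i₀ β V) :
    edgePoint P.natDegree i₀ β i₀ = latticePoint β (P.natDegree - i₀) := by
  have h1 : (i₀ : ℝ) ≠ 0 := by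
    have := h.two_le
    exact_mod_cast (by omega : i₀ ≠ 0)
  rw [edgePoint, latticePoint, Nat.cast_sub h.le_natDegree]
  congr 1
  ext l
  field_simp

theorem edgePoint_mem (h : HasDominantCoef P i₀ β V) :
    edgePoint P.natDegree i₀ β i₀ ∈ newtonPolyhedron P := by
  rw [h.edgePoint_eq_latticePoint]
  exact mem_newtonPolyhedron_of_coeff_ne_zero h.coeff_ne_zero

theorem edgePoint_mem_edgeSegment (h : HasDominantCoef P i₀ β V) :
    edgePoint P.natDegree i₀ β i₀ ∈ edgeSegment P i₀ β := by
  rw [h.edgeSegment_eq]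
  exact ⟨i₀, ⟨Nat.cast_nonneg _, by exact_mod_cast h.le_natDegree⟩, rfl⟩

theorem topPoint_mem_edgeSegment : topPoint P ∈ edgeSegment P i₀ β := left_mem_segment _ _ _

theorem edgePoint_ne_topPoint (h : HasDominantCoef P i₀ β V) :
    edgePoint P.natDegree i₀ β i₀ ≠ topPoint P := by
  intro h1
  have h2 := congrArg Prod.snd h1
  simp only [edgePoint, topPoint] at h2
  have h3 : (i₀ : ℝ) = 0 := by linarith
  have := h.two_le
  norm_cast at h3
  omega

theorem newtonPolyhedron_subset (h : HasDominantCoef P i₀ β V) :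
    newtonPolyhedron P ⊆ ⋃ s ∈ edgeSegment P i₀ β, Set.Ici s := by
  refine convexHull_min ?_ (convex_iUnion_Ici (convex_segment _ _))
  refine Set.iUnion₂_subset fun a ha => ?_
  obtain ⟨m, k, hmk, rfl⟩ := ha
  suffices ∃ s ∈ edgeSegment P i₀ β, s ≤ latticePoint m k by
    obtain ⟨s, hs, hle⟩ := this
    exact fun x hx => Set.mem_biUnion hs (hle.trans hx)
  have hk : k ≤ P.natDegree := by
    by_contra hk
    rw [coeff_eq_zero_of_natDegree_lt (not_le.mp hk), map_zero] at hmk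
    exact hmk rfl
  refine ⟨edgePoint P.natDegree i₀ β ((P.natDegree - k : ℕ) : ℝ), ?_, fun l => ?_, ?_⟩
  · rw [h.edgeSegment_eq]
    exact ⟨_, ⟨Nat.cast_nonneg _, by exact_mod_cast Nat.sub_le _ _⟩, rfl⟩
  · have hi₀ : (0 : ℝ) < i₀ := by
      have := h.two_le
      exact_mod_cast (by omega : 0 < i₀)
    rcases hk.eq_or_lt with rfl | hk'
    · simp [edgePoint, latticePoint]
    · have h1 := h.le (P.natDegree - k) (Finset.mem_Icc.mpr ⟨by omega, Nat.sub_le _ _⟩) m (by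
        rwa [coef, Nat.sub_sub_self hk]) l
      change ((P.natDegree - k : ℕ) : ℝ) * (β l / i₀) ≤ m l
      rw [← mul_div_assoc, div_le_iff₀ hi₀, mul_comm (m l : ℝ)]
      exact_mod_cast h1
  · change (P.natDegree : ℝ) - ((P.natDegree - k : ℕ) : ℝ) ≤ k
    rw [Nat.cast_sub hk]
    linarith

/-- The part of `P` on the segment has no term of degree `d - 1`, so as a power of a linear form it
would be a multiple of `Z ^ d`; but it contains the term of exponent `(β, d - i₀)`. -/
theorem not_isPowerOfLinearForm (h : HasDominantCoef P i₀ β V) (hP : P.Monic) [CharZero K]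
    (hP1 : coef P 1 = 0) : ¬ IsPowerOfLinearForm (restrict P (edgeSegment P i₀ β)) := by
  rintro ⟨a, b, k, hk⟩
  have hi₀ := h.two_le
  have hi₀d := h.le_natDegree
  set d := P.natDegree with hd
  have hcoeff : ∀ j, (restrict P (edgeSegment P i₀ β)).coeff j =
      a ^ j * b ^ (k - j) * (k.choose j : MvPowerSeries (Fin n) K) := fun j => by
    rw [hk, coeff_linear_pow]
  have hzero : ∀ j, P.coeff j = 0 → (restrict P (edgeSegment P i₀ β)).coeff j = 0 := fun j hj => by
    ext m
    rw [map_zero]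
    by_cases hm : latticePoint m j ∈ edgeSegment P i₀ β
    · rw [(coeff_coeff_restrict _ j m).1 hm, hj, map_zero]
    · exact (coeff_coeff_restrict _ j m).2 hm
  have htop : (restrict P (edgeSegment P i₀ β)).coeff d ≠ 0 := by
    intro h0
    have h1 := (coeff_coeff_restrict (P := P) (edgeSegment P i₀ β) d 0).1 (by
      have := topPoint_mem_edgeSegment (P := P) (i₀ := i₀) (β := β)
      simpa [latticePoint, topPoint, Pi.zero_def] using this)
    rw [h0, map_zero, hP.coeff_natDegree] at h1
    simp at h1
  have hmid : (restrict P (edgeSegment P i₀ β)).coeff (d - i₀) ≠ 0 := by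
    intro h0
    have h1 := (coeff_coeff_restrict (P := P) (edgeSegment P i₀ β) (d - i₀) β).1 (by
      rw [← h.edgePoint_eq_latticePoint]
      exact h.edgePoint_mem_edgeSegment)
    rw [h0, map_zero] at h1
    exact h.coeff_ne_zero h1.symm
  have ha : a ≠ 0 := by
    rintro rfl
    rw [hcoeff, zero_pow (by omega), zero_mul, zero_mul] at htop
    exact htop rfl
  have hkd : k = d := by
    refine le_antisymm ?_ ?_
    · by_contra hlt
      have h1 := hzero k (coeff_eq_zero_of_natDegree_lt (not_le.mp hlt))
      rw [hcoeff, Nat.sub_self, pow_zero, mul_one, Nat.choose_self, Nat.cast_one, mul_one] at h1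
      exact pow_ne_zero _ ha h1
    · by_contra hlt
      rw [hcoeff, Nat.choose_eq_zero_of_lt (not_le.mp hlt), Nat.cast_zero, mul_zero] at htop
      exact htop rfl
  subst hkd
  have hb : b = 0 := by
    have h1 := hzero (d - 1) hP1
    rw [hcoeff, Nat.sub_sub_self (by omega), pow_one] at h1
    have h2 : (d.choose (d - 1) : MvPowerSeries (Fin n) K) ≠ 0 :=
      Nat.cast_ne_zero.mpr (Nat.choose_pos (Nat.sub_le _ _)).ne'
    exact (mul_eq_zero.mp ((mul_eq_zero.mp h1).resolve_right h2)).resolve_left (pow_ne_zero _ ha)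
  rw [hcoeff, hb, Nat.sub_sub_self hi₀d, zero_pow (by omega), mul_zero, zero_mul] at hmid
  exact hmid rfl

theorem isNuQuasiOrdinary (h : HasDominantCoef P i₀ β V) (hP : P.Monic) [CharZero K]
    (hP1 : coef P 1 = 0) : IsNuQuasiOrdinary P := by
  have hi₀ : (i₀ : ℝ) ≠ 0 := by
    have := h.two_le
    exact_mod_cast (by omega : i₀ ≠ 0)
  refine ⟨_, h.edgePoint_mem, h.edgePoint_ne_topPoint, edgePoint P.natDegree i₀ β P.natDegree,
    sub_self _, ?_, h.newtonPolyhedron_subset, h.not_isPowerOfLinearForm hP hP1⟩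
  have : edgePoint P.natDegree i₀ β P.natDegree = AffineMap.lineMap (topPoint P)
      (edgePoint P.natDegree i₀ β i₀) ((P.natDegree : ℝ) / i₀) := by
    rw [← edgePoint_zero P i₀ β, AffineMap.lineMap_apply_module]
    ext l
    · simp [edgePoint]; field_simp
    · simp [edgePoint]; field_simp; ring
  rw [this]
  exact AffineMap.lineMap_mem_affineSpan_pair _ _ _

/-- The face of the Newton polyhedron cut out by a functional that is negative on the orthant and
constant on the segment. -/
theorem argmax_eq (h : HasDominantCoef P i₀ β V) (hP : P.Monic)
    {f : (Fin n → ℝ) × ℝ →ₗ[ℝ] ℝ} (h1 : ∀ l, f (Pi.single l 1, 0) < 0) (h2 : f (0, 1) < 0)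
    (hS : ∀ s ∈ edgeSegment P i₀ β, f s = f (topPoint P)) :
    {x ∈ newtonPolyhedron P | ∀ y ∈ newtonPolyhedron P, f y ≤ f x} =
      newtonPolyhedron P ∩ edgeSegment P i₀ β := by
  have hlt : ∀ x ∈ newtonPolyhedron P, f x ≤ f (topPoint P) ∧
      (f x = f (topPoint P) → x ∈ edgeSegment P i₀ β) := by
    intro x hx
    have := h.newtonPolyhedron_subset hx
    simp only [Set.mem_iUnion, Set.mem_Ici, exists_prop] at this
    obtain ⟨s, hs, hsx⟩ := this
    rw [← hS s hs]
    by_cases hne : s = x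
    · rw [← hne]; exact ⟨le_rfl, fun _ => hs⟩
    · have := lt_of_neg_of_le h1 h2 hsx hne
      exact ⟨this.le, fun h => absurd h this.ne⟩
  ext x
  constructor
  · rintro ⟨hx, hmax⟩
    exact ⟨hx, (hlt x hx).2 (le_antisymm (hlt x hx).1
      (hmax _ (topPoint_mem_newtonPolyhedron hP)))⟩
  · rintro ⟨hx, hxS⟩
    exact ⟨hx, fun y hy => (hlt y hy).1.trans_eq (hS x hxS).symm⟩

/-- The segment is bounded, so it contains finitely many lattice points. -/
theorem finite_exponents_inter (h : HasDominantCoef P i₀ β V) :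
    (exponents P ∩ edgeSegment P i₀ β).Finite := by
  refine ((Finset.finite_toSet (Finset.Iic (P.natDegree • β) ×ˢ Finset.Iic P.natDegree)).image
    fun p : (Fin n →₀ ℕ) × ℕ => latticePoint p.1 p.2).subset ?_
  rintro _ ⟨⟨m, k, -, rfl⟩, hS⟩
  refine ⟨(m, k), ?_, rfl⟩
  rw [h.edgeSegment_eq] at hS
  obtain ⟨t, ht, hmk⟩ := hS
  have hi₀ : (1 : ℝ) ≤ i₀ := by
    have := h.two_le
    exact_mod_cast (by omega : 1 ≤ i₀)
  simp only [Finset.coe_product, Finset.coe_Iic, Set.mem_prod, Set.mem_Iic]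
  constructor
  · intro l
    have h1 := congrFun (congrArg Prod.fst hmk) l
    simp only [edgePoint, latticePoint] at h1
    have h2 : (m l : ℝ) ≤ P.natDegree * β l := by
      rw [← h1]
      exact mul_le_mul ht.2 (div_le_self (Nat.cast_nonneg _) hi₀)
        (div_nonneg (Nat.cast_nonneg _) (Nat.cast_nonneg _)) (Nat.cast_nonneg _)
    simpa using (by exact_mod_cast h2 : m l ≤ P.natDegree * β l)
  · have h1 := congrArg Prod.snd hmk
    simp only [edgePoint, latticePoint] at h1
    have h2 : (k : ℝ) ≤ P.natDegree := by linarith [ht.1]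
    exact_mod_cast h2

/-- The Newton polyhedron is a convex hull of an infinite union of orthants, but its intersection
with the segment is the convex hull of the finitely many exponents on the segment. -/
theorem isCompact_inter (h : HasDominantCoef P i₀ β V) (hP : P.Monic)
    {f : (Fin n → ℝ) × ℝ →ₗ[ℝ] ℝ} (h1 : ∀ l, f (Pi.single l 1, 0) < 0) (h2 : f (0, 1) < 0)
    (hS : ∀ s ∈ edgeSegment P i₀ β, f s = f (topPoint P)) :
    IsCompact (newtonPolyhedron P ∩ edgeSegment P i₀ β) := by
  have hA : ∀ a ∈ ⋃ a ∈ exponents P, Set.Ici a, f a ≤ f (topPoint P) := by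
    intro a ha
    have h3 := subset_convexHull ℝ _ ha
    have h4 := h.argmax_eq hP h1 h2 hS
    have h5 : topPoint P ∈ newtonPolyhedron P ∩ edgeSegment P i₀ β :=
      ⟨topPoint_mem_newtonPolyhedron hP, topPoint_mem_edgeSegment⟩
    rw [← h4] at h5
    exact h5.2 a h3
  have heq : newtonPolyhedron P ∩ edgeSegment P i₀ β =
      convexHull ℝ (exponents P ∩ edgeSegment P i₀ β) := by
    apply Set.Subset.antisymm
    · rintro x ⟨hx, hxS⟩
      refine convexHull_mono ?_ (mem_convexHull_of_forall_le f hA hx (hS x hxS))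
      rintro a ⟨ha, haf⟩
      have h3 := subset_convexHull ℝ _ ha
      have haS : a ∈ edgeSegment P i₀ β := by
        have h4 := h.argmax_eq hP h1 h2 hS
        have h5 : a ∈ {x ∈ newtonPolyhedron P | ∀ y ∈ newtonPolyhedron P, f y ≤ f x} := by
          refine ⟨h3, fun y hy => ?_⟩
          rw [haf]
          have h6 : topPoint P ∈ newtonPolyhedron P ∩ edgeSegment P i₀ β :=
            ⟨topPoint_mem_newtonPolyhedron hP, topPoint_mem_edgeSegment⟩
          rw [← h4] at h6
          exact h6.2 y hy
        rw [h4] at h5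
        exact h5.2
      refine ⟨?_, haS⟩
      simp only [Set.mem_iUnion, Set.mem_Ici, exists_prop] at ha
      obtain ⟨b, hb, hba⟩ := ha
      by_cases hne : b = a
      · rwa [← hne]
      · have h7 := lt_of_neg_of_le h1 h2 hba hne
        rw [haf] at h7
        exact absurd (hA b (Set.mem_biUnion hb Set.self_mem_Ici)) (not_le.mpr h7)
    · refine convexHull_min (fun a ha => ⟨?_, ha.2⟩)
        ((convex_convexHull ℝ _).inter (convex_segment _ _))
      exact subset_convexHull ℝ _ (Set.mem_biUnion ha.1 Set.self_mem_Ici)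
  rw [heq]
  exact h.finite_exponents_inter.isCompact_convexHull ℝ

theorem finrank_vectorSpan_inter (h : HasDominantCoef P i₀ β V) (hP : P.Monic) :
    Module.finrank ℝ (vectorSpan ℝ (newtonPolyhedron P ∩ edgeSegment P i₀ β)) = 1 := by
  apply le_antisymm
  · rw [← collinear_iff_finrank_le_one, collinear_iff_exists_forall_eq_smul_vadd]
    refine ⟨topPoint P, (fun l => β l / i₀, -1), ?_⟩
    rintro p ⟨-, hp⟩
    rw [h.edgeSegment_eq] at hp
    obtain ⟨t, -, rfl⟩ := hp
    refine ⟨t, ?_⟩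
    rw [← edgePoint_zero P i₀ β]
    ext l
    · simp [edgePoint]
    · simp [edgePoint]; ring
  · rw [Nat.one_le_iff_ne_zero]
    intro h0
    have h1 := Submodule.finrank_eq_zero.mp h0
    have h2 := vsub_mem_vectorSpan ℝ
      (s := newtonPolyhedron P ∩ edgeSegment P i₀ β)
      ⟨h.edgePoint_mem, h.edgePoint_mem_edgeSegment⟩
      ⟨topPoint_mem_newtonPolyhedron hP, topPoint_mem_edgeSegment⟩
    rw [h1, Submodule.mem_bot, vsub_eq_zero_iff_eq] at h2
    exact h.edgePoint_ne_topPoint h2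

/-- A functional `f` that exposes a compact face at the top point is negative on the orthant. It
does not increase along the segment, and if it decreased, its maximum on the orthants over the
segment would be attained only at the top point, but an edge has more points. So `f` is constant on
the segment. -/
theorem eq_inter_of_isCompactEdge (h : HasDominantCoef P i₀ β V) (hP : P.Monic)
    {F : Set ((Fin n → ℝ) × ℝ)} (hF : IsCompactEdge (newtonPolyhedron P) F)
    (htop : topPoint P ∈ F) : F = newtonPolyhedron P ∩ edgeSegment P i₀ β := by
  obtain ⟨hne, hexp, hcomp, hrank⟩ := hF
  obtain ⟨f, rfl⟩ := hexp hne
  set F := {x ∈ newtonPolyhedron P | ∀ y ∈ newtonPolyhedron P, f y ≤ f x} with hFdef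
  -- a direction of the orthant along which `f` does not decrease would make the face unbounded
  have hneg : ∀ e : (Fin n → ℝ) × ℝ, 0 ≤ e → e ≠ 0 → f e < 0 := by
    intro e he he0
    by_contra hcon
    rw [not_lt] at hcon
    have hmem : ∀ r : ℝ, 0 ≤ r → topPoint P + r • e ∈ F := by
      intro r hr
      refine ⟨newtonPolyhedron_mem_of_le htop.1 (le_add_of_nonneg_right (smul_nonneg hr he)),
        fun y hy => (htop.2 y hy).trans ?_⟩
      rw [map_add, map_smul, smul_eq_mul]
      exact le_add_of_nonneg_right (mul_nonneg hr hcon)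
    obtain ⟨M, hM⟩ := hcomp.isBounded.exists_norm_le
    have hepos : 0 < ‖e‖ := norm_pos_iff.mpr he0
    have h1 := hM _ (hmem ((|M| + ‖topPoint P‖ + 1) / ‖e‖) (by positivity))
    have h2 : ‖((|M| + ‖topPoint P‖ + 1) / ‖e‖) • e‖ = |M| + ‖topPoint P‖ + 1 := by
      rw [norm_smul, Real.norm_of_nonneg (by positivity), div_mul_cancel₀ _ hepos.ne']
    have h3 := norm_sub_le (topPoint P + ((|M| + ‖topPoint P‖ + 1) / ‖e‖) • e) (topPoint P)
    rw [add_sub_cancel_left, h2] at h3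
    linarith [le_abs_self M]
  have h1 : ∀ l, f.toLinearMap (Pi.single l 1, 0) < 0 := by
    intro l
    refine hneg _ ⟨fun k => ?_, le_rfl⟩ fun h0 => ?_
    · by_cases hk : k = l
      · subst hk; simp
      · simp [hk]
    · have := congrFun (congrArg Prod.fst h0) l
      simp at this
  have h2 : f.toLinearMap (0, 1) < 0 :=
    hneg _ ⟨le_rfl, zero_le_one⟩ fun h0 => by simpa using congrArg Prod.snd h0
  set v : (Fin n → ℝ) × ℝ := (fun l => β l / i₀, -1) with hv
  have hseg : ∀ t, edgePoint P.natDegree i₀ β t = topPoint P + t • v := by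
    intro t
    rw [← edgePoint_zero P i₀ β]
    ext l
    · simp [edgePoint, hv]
    · simp [edgePoint, hv]; ring
  have hfv : f v ≤ 0 := by
    have h3 := htop.2 _ h.edgePoint_mem
    rw [hseg, map_add, map_smul, smul_eq_mul] at h3
    have hi₀ : (0 : ℝ) < i₀ := by
      have := h.two_le
      exact_mod_cast (by omega : 0 < i₀)
    by_contra hcon
    rw [not_le] at hcon
    have := mul_pos hi₀ hcon
    linarith
  obtain ⟨x, hxF, hxne⟩ : ∃ x ∈ F, x ≠ topPoint P := by
    by_contra! hall
    have h3 : F = {topPoint P} := Set.eq_singleton_iff_unique_mem.mpr ⟨htop, hall⟩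
    rw [h3, vectorSpan_singleton, finrank_bot] at hrank
    exact zero_ne_one hrank
  have hfv0 : f v = 0 := by
    have h3 := h.newtonPolyhedron_subset hxF.1
    simp only [Set.mem_iUnion, Set.mem_Ici, exists_prop] at h3
    obtain ⟨s, hs, hsx⟩ := h3
    rw [h.edgeSegment_eq] at hs
    obtain ⟨t, ht, rfl⟩ := hs
    have h4 : f (topPoint P) ≤ f x := hxF.2 _ htop.1
    have h5 : f x ≤ f (edgePoint P.natDegree i₀ β t) := by
      by_cases hne : edgePoint P.natDegree i₀ β t = x
      · rw [hne]
      · exact (lt_of_neg_of_le h1 h2 hsx hne).le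
    have h6 : 0 < t := by
      refine ht.1.lt_of_ne ?_
      rintro rfl
      rw [edgePoint_zero] at hsx
      exact absurd h4 (not_le.mpr (lt_of_neg_of_le h1 h2 hsx hxne.symm))
    rw [hseg, map_add, map_smul, smul_eq_mul] at h5
    by_contra hcon
    have := mul_neg_of_pos_of_neg h6 (hfv.lt_of_ne hcon)
    linarith
  refine h.argmax_eq hP (f := f.toLinearMap) h1 h2 fun s hs => ?_
  rw [h.edgeSegment_eq] at hs
  obtain ⟨t, -, rfl⟩ := hs
  change f (edgePoint P.natDegree i₀ β t) = f (topPoint P)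
  rw [hseg, map_add, map_smul, hfv0, smul_zero, add_zero]

/-- The hypothesis on the constant coefficient says that `β ≠ 0`, so that the segment is not
vertical. -/
theorem existsUnique_isCompactEdge (h : HasDominantCoef P i₀ β V) (hP : P.Monic)
    (hβ : MvPowerSeries.constantCoeff (coef P i₀) = 0) :
    ∃! F : Set ((Fin n → ℝ) × ℝ), IsCompactEdge (newtonPolyhedron P) F ∧ topPoint P ∈ F := by
  have hmem : topPoint P ∈ newtonPolyhedron P ∩ edgeSegment P i₀ β :=
    ⟨topPoint_mem_newtonPolyhedron hP, topPoint_mem_edgeSegment⟩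
  have hi₀ : (0 : ℝ) < i₀ := by
    have := h.two_le
    exact_mod_cast (by omega : 0 < i₀)
  set c : ℝ := ∑ l, (β l / i₀ : ℝ) with hc
  have hnonneg : ∀ l ∈ Finset.univ, (0 : ℝ) ≤ β l / i₀ := fun l _ =>
    div_nonneg (Nat.cast_nonneg _) hi₀.le
  have hc0 : 0 < c := by
    refine (Finset.sum_nonneg hnonneg).lt_of_ne fun h0 => ?_
    rw [eq_comm, Finset.sum_eq_zero_iff_of_nonneg hnonneg] at h0
    have hβ0 : β = 0 := Finsupp.ext fun l => by
      simpa [hi₀.ne'] using h0 l (Finset.mem_univ l)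
    rw [h.coef_eq, hβ0, MvPowerSeries.monomial_zero_one, one_mul] at hβ
    exact h.constantCoeff_ne_zero hβ
  -- minus the weighted degree that is constant on the segment
  let f : StrongDual ℝ ((Fin n → ℝ) × ℝ) :=
    -((∑ l, (ContinuousLinearMap.proj l).comp (ContinuousLinearMap.fst ℝ (Fin n → ℝ) ℝ)) +
      c • ContinuousLinearMap.snd ℝ (Fin n → ℝ) ℝ)
  have hf : ∀ x, f x = -(∑ l, x.1 l + c * x.2) := fun x => by
    simp [f]
  have h1 : ∀ l, f.toLinearMap (Pi.single l 1, 0) < 0 := fun l => by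
    change f (Pi.single l 1, 0) < 0
    rw [hf]
    simp
  have h2 : f.toLinearMap (0, 1) < 0 := by
    change f (0, 1) < 0
    rw [hf]
    simpa using hc0
  have hS : ∀ s ∈ edgeSegment P i₀ β, f.toLinearMap s = f.toLinearMap (topPoint P) := by
    intro s hs
    rw [h.edgeSegment_eq] at hs
    obtain ⟨t, -, rfl⟩ := hs
    change f _ = f _
    rw [hf, hf]
    simp only [edgePoint, topPoint, ← Finset.mul_sum, ← hc]
    simp
    ring
  exact ⟨newtonPolyhedron P ∩ edgeSegment P i₀ β, ⟨⟨⟨_, hmem⟩,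
    fun _ => ⟨f, (h.argmax_eq hP h1 h2 hS).symm⟩, h.isCompact_inter hP h1 h2 hS,
    h.finrank_vectorSpan_inter hP⟩, hmem⟩, fun F hF => h.eq_inter_of_isCompactEdge hP hF.1 hF.2⟩

end HasDominantCoef

end AbhyankarJung

end

/-- Let `P = Z^d + a_2 Z^(d-2) + ⋯ + a_d` be a quasi-ordinary Weierstrass polynomial of degree
`d ≥ 2` with `a_1 = 0`. Then the ideal `(a_i^(d!/i))_{i = 2, …, d}` is generated by a monomial and
by one of the `a_i^(d!/i)`; `P` is `ν`-quasi-ordinary; and its Newton polyhedron has exactly one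
compact edge containing `R₀ = (0, …, 0, d)`. -/
theorem theorem1 {K : Type*} [Field K] [IsAlgClosed K] [CharZero K] (n d : ℕ) (hd : 2 ≤ d)
    (P : Polynomial (MvPowerSeries (Fin n) K))
    (hW : AbhyankarJung.IsWeierstrass P d)
    (hqo : AbhyankarJung.IsQuasiOrdinary P)
    (ha1 : AbhyankarJung.coef P 1 = 0) :
    ((∃ γ : Fin n →₀ ℕ,
        AbhyankarJung.coefIdeal P = Ideal.span {MvPowerSeries.monomial γ (1 : K)}) ∧
      (∃ i ∈ Finset.Icc 2 d,
        AbhyankarJung.coefIdeal P =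
          Ideal.span {AbhyankarJung.coef P i ^ (d.factorial / i)})) ∧
    AbhyankarJung.IsNuQuasiOrdinary P ∧
    (∃! F : Set ((Fin n → ℝ) × ℝ),
      AbhyankarJung.IsCompactEdge (AbhyankarJung.newtonPolyhedron P) F ∧
        AbhyankarJung.topPoint P ∈ F) := by
  obtain ⟨hP, rfl, hW0⟩ := hW
  obtain ⟨i₀, β, V, h⟩ := AbhyankarJung.exists_hasDominantCoef hP hd ha1 hqo
  have hi₀ : 1 ≤ i₀ := le_trans one_le_two h.two_le
  exact ⟨⟨⟨_, h.coefIdeal_eq.1⟩, i₀, Finset.mem_Icc.mpr ⟨h.two_le, h.le_natDegree⟩,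
      h.coefIdeal_eq.2⟩, h.isNuQuasiOrdinary hP ha1,
    h.existsUnique_isCompactEdge hP (hW0 i₀ (Finset.mem_Icc.mpr ⟨hi₀, h.le_natDegree⟩))⟩
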